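/- Let $p$ be a prime. For a closed subgroup $H$ of a profinite group $G$ put $\mathrm{Ob}_G(H) = H \cap \bigcap\{K \unlhd_o G : K \not\le H\}$ (the intersection runs over open normal subgroups $K$ of $G$), let $\mathrm{I}_n(G)$ be the intersection of all open normal subgroups of $G$ of index at most $n$, and put $\mathrm{ob}_G(n) = |G : \mathrm{Ob}_G(\mathrm{I}_n(G))| \in \mathbb{N}\cup\{\infty\}$. Let $\gamma_1(G) = G$ and let $\gamma_{i+1}(G)$ be the closure of $[\gamma_i(G), G]$. For a pro-$p$ group $G$ all of whose subgroups $\gamma_i(G)$ are open, the obliquity of $G$ is $o(G) = \sup_i \log_p |\gamma_{i+1}(G) : \mathrm{Ob}_G(\gamma_{i+1}(G))| \in [0,\infty]$. "$G$ has finite obliquity" means that all $\gamma_i(G)$ are open and $o(G) < \infty$. **Proposition.** (i) For every integer $n \ge 1$, $\mathrm{ob}_{\mathbb{Z}_p}(n)$ is the largest power $p^k$ ($k \ge 0$) with $p^k \le n$. Now let $G$ be a pro-$p$ group. (ii) There is a constant $k$ such that $\mathrm{ob}_G(n) \le kn$ for all $n \ge 1$ if and only if $G \cong \mathbb{Z}_p$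 (as topological groups) or $G$ has finite obliquity. (iii) Suppose that $G$ has finite obliquity $o$. Then there are non-negative integers $w$ and $c$ such that (a) $|\gamma_i(G) : \gamma_{i+1}(G)| \le p^w$ for all $i \ge 1$, and (b) $|N : N \cap M| \le p^c$ for all closed normal subgroups $N$, $M$ of $G$ with $M \not\le N$. If moreover $G$ has more than $p$ elements, then for all non-negative integers $w$ and $c$ that satisfy (a) and (b), \[ \mathrm{ob}_G(p^n) \le p^{\,n+c+w+o-2} \quad \text{for all integers } n \ge 0. \] (iv) If $k \geq 0$ is a real constant such that $\mathrm{ob}_G(n) \le kn$ for all $n \ge 1$, then $G \cong \mathbb{Z}_p$, or all subgroups $\gamma_i(G)$ are open and $o(G) \le \log_p(k)$. -/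

import Mathlib

open scoped ENNReal NNReal

/-- The index `|G : H|` in `ℕ ∪ {∞}`. -/
noncomputable def eindex {G : Type*} [Group G] (H : Subgroup G) : ℕ∞ := ENat.card (G ⧸ H)

/-- The index `|H : H ∩ K|` in `ℕ ∪ {∞}`; it is `|H : K|` when `K ≤ H`. -/
noncomputable def erelIndex {G : Type*} [Group G] (H K : Subgroup G) : ℕ∞ :=
  eindex (K.subgroupOf H)

/-- A profinite group (that is, a compact, Hausdorff, totally disconnected topological group) is
pro-`p` if the index of every open normal subgroup is a power of `p`. -/
def IsProP (p : ℕ) (G : Type*) [Group G] [TopologicalSpace G] [IsTopologicalGroup G]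
    [CompactSpace G] [T2Space G] [TotallyDisconnectedSpace G] : Prop :=
  ∀ N : Subgroup G, N.Normal → IsOpen (N : Set G) → ∃ k : ℕ, eindex N = (p : ℕ∞) ^ k

/-- The oblique core `Ob_G(H)`: the intersection of `H` with all open normal subgroups of `G`
that are not contained in `H`. -/
def obliqueCore {G : Type*} [Group G] [TopologicalSpace G] (H : Subgroup G) : Subgroup G :=
  H ⊓ sInf {K : Subgroup G | K.Normal ∧ IsOpen (K : Set G) ∧ ¬ K ≤ H}

/-- The intersection `I_n(G)` of all open normal subgroups of `G` of index at most `n`. -/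
noncomputable def normalIndexCore (G : Type*) [Group G] [TopologicalSpace G] (n : ℕ) :
    Subgroup G :=
  sInf {K : Subgroup G | K.Normal ∧ IsOpen (K : Set G) ∧ eindex K ≤ (n : ℕ∞)}

/-- The generalised obliquity function `ob_G : n ↦ |G : Ob_G(I_n(G))|`. -/
noncomputable def obFun (G : Type*) [Group G] [TopologicalSpace G] (n : ℕ) : ℕ∞ :=
  eindex (obliqueCore (normalIndexCore G n))

/-- `ob_G(n) ≤ k n` for all positive integers `n`. -/
def ObLinearBound (G : Type*) [Group G] [TopologicalSpace G] (k : ℝ≥0) : Prop :=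
  ∀ n : ℕ, 1 ≤ n → (obFun G n : ℝ≥0∞) ≤ (k : ℝ≥0∞) * (n : ℝ≥0∞)

/-- The lower central series of a topological group, consisting of closed subgroups and indexed
from `0`: `lowerCentral G i` is the subgroup usually written `γ_{i+1}(G)`. So
`lowerCentral G 0 = γ_1(G) = G`, and `lowerCentral G (i + 1)` is the closure of the subgroup
generated by the commutators of elements of `lowerCentral G i` with elements of `G`. -/
def lowerCentral (G : Type*) [Group G] [TopologicalSpace G] [IsTopologicalGroup G] :
    ℕ → Subgroup G
  | 0 => ⊤
  | i + 1 => (⁅lowerCentral G i, (⊤ : Subgroup G)⁆).topologicalClosure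

/-- The `i`-th obliquity `o_i(G) = log_p |γ_{i+1}(G) : Ob_G(γ_{i+1}(G))|`, where
`log_p ∞ = ∞`. -/
noncomputable def ithObliquity (p : ℕ) (G : Type*) [Group G] [TopologicalSpace G]
    [IsTopologicalGroup G] (i : ℕ) : EReal :=
  ENNReal.log (erelIndex (lowerCentral G i) (obliqueCore (lowerCentral G i)) : ℝ≥0∞) /
    ((Real.log (p : ℝ) : ℝ) : EReal)

/-- The obliquity `o(G) = sup_i o_i(G)`. It is meant for groups all of whose lower central
subgroups are open. -/
noncomputable def obliquity (p : ℕ) (G : Type*) [Group G] [TopologicalSpace G]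
    [IsTopologicalGroup G] : EReal :=
  ⨆ i : ℕ, ithObliquity p G i

/-- All lower central subgroups are open: the condition under which the obliquity is defined. -/
def LowerCentralOpen (G : Type*) [Group G] [TopologicalSpace G] [IsTopologicalGroup G] : Prop :=
  ∀ i : ℕ, IsOpen (lowerCentral G i : Set G)

/-- The obliquity of `G` is defined and finite. -/
def HasFiniteObliquity (p : ℕ) (G : Type*) [Group G] [TopologicalSpace G]
    [IsTopologicalGroup G] : Prop :=
  LowerCentralOpen G ∧ obliquity p G < ⊤

/-- `|γ_i(G) : γ_{i+1}(G)| ≤ p ^ w` for all `i ≥ 1`. -/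
def LowerCentralWidthLE (p : ℕ) (G : Type*) [Group G] [TopologicalSpace G]
    [IsTopologicalGroup G] (w : ℕ) : Prop :=
  ∀ i : ℕ, erelIndex (lowerCentral G i) (lowerCentral G (i + 1)) ≤ (p : ℕ∞) ^ w

/-- `|N : N ∩ M| ≤ p ^ c` for all closed normal subgroups `N` and `M` of `G` such that `M` is not
contained in `N`. -/
def NormalIntersectionLE (p : ℕ) (G : Type*) [Group G] [TopologicalSpace G] (c : ℕ) : Prop :=
  ∀ N M : Subgroup G, N.Normal → IsClosed (N : Set G) → M.Normal → IsClosed (M : Set G) →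
    ¬ M ≤ N → erelIndex N M ≤ (p : ℕ∞) ^ c

/-!
Two facts about the oblique core carry the argument: it is monotone, and every closed normal
subgroup `M` that is not contained in `H` contains `Ob_G(H)` (`obliqueCore_le_of_not_le`), since
`M` is an intersection of open normal subgroups. Below, `γ_i` is `lowerCentral G (i - 1)`.

*`ℤ_p`.* The open subgroups of `ℤ_p` form a chain. In a group whose open normal subgroups form a
chain, `Ob_G(H) = H` for every open normal subgroup `H`, and `I_n(G)` is the open normal subgroup
of largest index at most `n` (`OpenNormalChain.exists_obFun_eq`).

*The invariants `w` and `c`.* For `x ∈ γ_i` the map `g ↦ [x, g]` induces a homomorphism from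
`G / γ_2` to `γ_{i+1} / γ_{i+2}`. Hence the exponent of `γ_{i+1} / γ_{i+2}` divides that of
`G / γ_2` (`pow_mem_lowerCentral_succ`), and the normal closure of an element of `γ_i` outside
`γ_{i+1}` is bounded modulo `γ_{i+2}`; as this normal closure contains `Ob_G(γ_{i+1})`, this
bounds `|γ_{i+1} : γ_{i+2}|` (`relIndex_lowerCentral_succ_le`). For `c`, let `M` be contained in
`γ_j` but not in `γ_{j+1}`, so that `M` contains `Ob_G(γ_{j+1})`. A closed normal subgroup that is
not contained in `γ_i` contains `Ob_G(γ_i)`, and with it a term of the series at bounded distance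
from `γ_i` (`IsProP.lowerCentral_le_of_relIndex_le`); so if `N` does not contain `M`, then `N`
lies in a term at bounded distance above `γ_{j+1}`, and `|N : N ∩ M|` is bounded.

*The explicit bound.* Let `γ_{i+1}` be the first term contained in `I = I_{p^n}(G)`. Then
`Ob_G(I)` contains `Ob_G(γ_{i+1})`, so it suffices to show `|G : γ_{i+1}| ≤ p^{n+c+w-2}`. Choose
an open normal subgroup `K` of index at most `p^n` and an element `z` of `γ_i` outside `K`, and
put `M = ⟨z⟩ γ_{i+1}`. Comparing `M ∩ K` with `K` and with `M` gives `|G : M| ≤ p^{n+c-1}`. If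
`G / γ_2` is not cyclic, then its exponent is at most `p^{w-1}`, so that `|M : γ_{i+1}| ≤ p^{w-1}`
(`NormalIntersectionLE.index_lowerCentral_succ_mul_le`). If `G / γ_2` is cyclic, then `G` is a
finite cyclic group and its subgroups form a chain.

*Linear growth.* If `ob_G(n) ≤ k n` and `γ_i` is open of index `n`, then `Ob_G(I_n) ≤ Ob_G(γ_i)`
gives `|γ_i : Ob_G(γ_i)| ≤ k` (`ObLinearBound.obliquity_le`). In any case all oblique cores
`Ob_G(I_n)` are open, which forces every nontrivial closed normal subgroup of `G` to be open
(`ObLinearBound.closedNormalOpen`). If some `γ_i` is not open, then `γ_i = 1` and `G` is infinite;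
as a central element of finite order would generate a finite open subgroup, `G` must be abelian
(otherwise the last nontrivial term of the series is central and torsion) and torsion-free, and
then procyclic (`ClosedNormalOpen.exists_topologicalClosure_zpowers_eq_top`). An infinite
procyclic pro-`p` group with generator `x` is isomorphic to `ℤ_p`: the closed subgroup of
`G × ℤ_p` generated by `(x, 1)` is the graph of an isomorphism
(`IsProP.nonempty_continuousMulEquiv_padicInt`).
-/

/-! ### Indices -/

section Index

variable {G : Type*} [Group G] {H K : Subgroup G}

theorem eindex_eq_index (h : H.index ≠ 0) : eindex H = (H.index : ℕ∞) := by
  have := Subgroup.index_ne_zero_iff_finite.1 h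
  rw [eindex, Subgroup.index, ENat.card_eq_coe_natCard]

theorem eindex_eq_top (h : H.index = 0) : eindex H = ⊤ := by
  have := Subgroup.index_eq_zero_iff_infinite.1 h
  rw [eindex, ENat.card_eq_top_of_infinite]

theorem eindex_le_natCast {n : ℕ} : eindex H ≤ n ↔ H.index ≠ 0 ∧ H.index ≤ n := by
  by_cases h : H.index = 0
  · simp [eindex_eq_top h, h]
  · rw [eindex_eq_index h, Nat.cast_le]
    simp [h]

theorem erelIndex_le_natCast {n : ℕ} :
    erelIndex H K ≤ n ↔ K.relIndex H ≠ 0 ∧ K.relIndex H ≤ n :=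
  eindex_le_natCast

theorem index_lt_of_lt_of_index_ne_zero (h : H < K) (hH : H.index ≠ 0) : K.index < H.index :=
  haveI : H.FiniteIndex := ⟨hH⟩
  Subgroup.index_strictAnti h

theorem normal_sInf {S : Set (Subgroup G)} (h : ∀ K ∈ S, K.Normal) : (sInf S).Normal := by
  refine ⟨fun x hx g => Subgroup.mem_sInf.2 fun K hK => ?_⟩
  exact (h K hK).conj_mem x (Subgroup.mem_sInf.1 hx K hK) g

end Index

/-! ### Open normal subgroups of profinite groups -/

section Profinite

variable {G : Type*} [Group G] [TopologicalSpace G]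

theorem index_ne_zero_of_isOpen [IsTopologicalGroup G] [CompactSpace G] {H : Subgroup G}
    (hH : IsOpen (H : Set G)) : H.index ≠ 0 :=
  Subgroup.index_ne_zero_iff_finite.2 (H.quotient_finite_of_isOpen hH)

theorem isOpen_of_isClosed_of_index_ne_zero [IsTopologicalGroup G] {H : Subgroup G}
    (hH : IsClosed (H : Set G)) (h : H.index ≠ 0) : IsOpen (H : Set G) :=
  haveI : H.FiniteIndex := ⟨h⟩
  H.isOpen_of_isClosed_of_finiteIndex hH

theorem isOpen_of_relIndex_ne_zero [IsTopologicalGroup G] [CompactSpace G] {H K : Subgroup G}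
    (hH : IsClosed (H : Set G)) (hK : IsOpen (K : Set G)) (hHK : H ≤ K)
    (h : H.relIndex K ≠ 0) : IsOpen (H : Set G) := by
  refine isOpen_of_isClosed_of_index_ne_zero hH ?_
  rw [← Subgroup.relIndex_mul_index hHK]
  exact mul_ne_zero h (index_ne_zero_of_isOpen hK)

theorem isClosed_sInf {S : Set (Subgroup G)} (h : ∀ K ∈ S, IsClosed (K : Set G)) :
    IsClosed ((sInf S : Subgroup G) : Set G) := by
  rw [Subgroup.coe_sInf]
  exact isClosed_biInter h

variable [IsTopologicalGroup G] [CompactSpace G] [TotallyDisconnectedSpace G]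

theorem exists_open_normal_notMem {x : G} (hx : x ≠ 1) :
    ∃ U : Subgroup G, U.Normal ∧ IsOpen (U : Set G) ∧ x ∉ U := by
  obtain ⟨U, hU⟩ := ProfiniteGrp.exist_openNormalSubgroup_sub_open_nhds_of_one
    (isOpen_compl_singleton (x := x)) (by simpa using hx.symm)
  exact ⟨U.toSubgroup, inferInstance, U.isOpen', fun h => hU h rfl⟩

/-- A closed normal subgroup is an intersection of open normal subgroups. -/
theorem exists_open_normal_ge_notMem {M : Subgroup G} (hM : M.Normal)
    (hMc : IsClosed (M : Set G)) {x : G} (hx : x ∉ M) :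
    ∃ U : Subgroup G, U.Normal ∧ IsOpen (U : Set G) ∧ M ≤ U ∧ x ∉ U := by
  obtain ⟨U, hU⟩ := ProfiniteGrp.exist_openNormalSubgroup_sub_open_nhds_of_one
    (U := (fun g => x * g) ⁻¹' (M : Set G)ᶜ)
    (hMc.isOpen_compl.preimage (continuous_const_mul x)) (by simpa using hx)
  refine ⟨M ⊔ U.toSubgroup, inferInstance, Subgroup.isOpen_mono le_sup_right U.isOpen',
    le_sup_left, fun h => ?_⟩
  obtain ⟨m, hm, u, hu, rfl⟩ := Subgroup.mem_sup_of_normal_right.1 h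
  exact hU (U.toSubgroup.inv_mem hu) (by simpa using hm)

end Profinite

/-! ### The oblique core -/

section ObliqueCore

variable {G : Type*} [Group G] [TopologicalSpace G]

theorem obliqueCore_le_self (H : Subgroup G) : obliqueCore H ≤ H := inf_le_left

theorem obliqueCore_mono {H K : Subgroup G} (h : H ≤ K) : obliqueCore H ≤ obliqueCore K :=
  inf_le_inf h (sInf_le_sInf fun _ hL => ⟨hL.1, hL.2.1, fun hLH => hL.2.2 (hLH.trans h)⟩)

theorem obliqueCore_normal {H : Subgroup G} (hH : H.Normal) : (obliqueCore H).Normal :=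
  haveI : (sInf {K : Subgroup G | K.Normal ∧ IsOpen (K : Set G) ∧ ¬ K ≤ H}).Normal :=
    normal_sInf fun _ hK => hK.1
  Subgroup.normal_inf_normal _ _

theorem isClosed_obliqueCore [IsTopologicalGroup G] {H : Subgroup G} (hH : IsClosed (H : Set G)) :
    IsClosed (obliqueCore H : Set G) := by
  rw [obliqueCore, Subgroup.coe_inf]
  exact hH.inter (isClosed_sInf fun K hK => K.isClosed_of_isOpen hK.2.1)

/-- The open normal subgroups in the definition of the oblique core may be replaced by closed
normal subgroups. -/
theorem obliqueCore_le_of_not_le [IsTopologicalGroup G] [CompactSpace G]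
    [TotallyDisconnectedSpace G] {H M : Subgroup G} (hM : M.Normal)
    (hMc : IsClosed (M : Set G)) (h : ¬ M ≤ H) : obliqueCore H ≤ M := by
  intro x hx
  by_contra hxM
  obtain ⟨U, hUn, hUo, hMU, hxU⟩ := exists_open_normal_ge_notMem hM hMc hxM
  exact hxU (Subgroup.mem_sInf.1 hx.2 U ⟨hUn, hUo, fun hU => h (hMU.trans hU)⟩)

theorem normalIndexCore_le {K : Subgroup G} (hK : K.Normal) (hKo : IsOpen (K : Set G)) {n : ℕ}
    (h : eindex K ≤ n) : normalIndexCore G n ≤ K :=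
  sInf_le ⟨hK, hKo, h⟩

end ObliqueCore

/-! ### The lower central series -/

section LowerCentral

open scoped commutatorElement

variable {G : Type*} [Group G] [TopologicalSpace G] [IsTopologicalGroup G]

theorem isClosed_lowerCentral (i : ℕ) : IsClosed (lowerCentral G i : Set G) := by
  cases i with
  | zero => exact isClosed_univ
  | succ i => exact Subgroup.isClosed_topologicalClosure _

instance lowerCentral_normal (i : ℕ) : (lowerCentral G i).Normal := by
  induction i with
  | zero => exact inferInstanceAs (⊤ : Subgroup G).Normal
  | succ i ih => exact Subgroup.is_normal_topologicalClosure _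

theorem commutatorElement_mem_lowerCentral {i : ℕ} {x : G} (hx : x ∈ lowerCentral G i) (g : G) :
    ⁅x, g⁆ ∈ lowerCentral G (i + 1) :=
  Subgroup.le_topologicalClosure _ (Subgroup.commutator_mem_commutator hx (Subgroup.mem_top g))

theorem lowerCentral_succ_le_of_isClosed {i : ℕ} {L : Subgroup G} (hL : IsClosed (L : Set G))
    (h : ∀ x ∈ lowerCentral G i, ∀ g, ⁅x, g⁆ ∈ L) : lowerCentral G (i + 1) ≤ L :=
  Subgroup.topologicalClosure_minimal _ (Subgroup.commutator_le.2 fun x hx g _ => h x hx g) hL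

theorem lowerCentral_succ_le (i : ℕ) : lowerCentral G (i + 1) ≤ lowerCentral G i :=
  Subgroup.topologicalClosure_minimal _ (Subgroup.commutator_le_left _ _)
    (isClosed_lowerCentral i)

theorem lowerCentral_antitone : Antitone (lowerCentral G) :=
  antitone_nat_of_succ_le lowerCentral_succ_le

/-- In a discrete quotient the closures in the definition of the lower central series disappear. -/
theorem map_mk'_lowerCentral {O : Subgroup G} [O.Normal] (hO : IsOpen (O : Set G)) (i : ℕ) :
    (lowerCentral G i).map (QuotientGroup.mk' O) =
      (⊤ : Subgroup (G ⧸ O)).lowerCentralSeries i := by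
  have htop : (⊤ : Subgroup G).map (QuotientGroup.mk' O) = ⊤ :=
    Subgroup.map_top_of_surjective _ (QuotientGroup.mk'_surjective O)
  induction i with
  | zero => exact htop
  | succ i ih =>
    have hcomm : (⁅lowerCentral G i, (⊤ : Subgroup G)⁆).map (QuotientGroup.mk' O) =
        (⊤ : Subgroup (G ⧸ O)).lowerCentralSeries (i + 1) := by
      rw [Subgroup.map_commutator, ih, htop, Subgroup.lowerCentralSeries_succ]
    rw [← hcomm]
    refine le_antisymm (Subgroup.map_le_iff_le_comap.2 ?_)
      (Subgroup.map_mono (Subgroup.le_topologicalClosure _))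
    refine Subgroup.topologicalClosure_minimal _ (Subgroup.le_comap_map _ _) ?_
    refine Subgroup.isClosed_of_isOpen _ (Subgroup.isOpen_mono (H₁ := O) ?_ hO)
    intro x hx
    have : QuotientGroup.mk' O x = 1 := (QuotientGroup.eq_one_iff x).2 hx
    exact Subgroup.mem_comap.2 (this ▸ Subgroup.one_mem _)

end LowerCentral

/-! ### Commutators modulo the lower central series -/

section CommutatorHom

open scoped commutatorElement

variable {Q : Type*} [Group Q]

/-- If all commutators `⁅x, g⁆` are central, then `g ↦ ⁅x, g⁆` is a homomorphism. -/
def commutatorHom (x : Q) (hx : ∀ g, ⁅x, g⁆ ∈ Subgroup.center Q) : Q →* Q :=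
  MonoidHom.mk' (fun g => ⁅x, g⁆) fun g h => by
    have hc := Subgroup.mem_center_iff.1 (hx h)
    rw [show ⁅x, g * h⁆ = ⁅x, g⁆ * (g * ⁅x, h⁆ * g⁻¹) by simp [commutatorElement_def, mul_assoc],
      hc g, mul_inv_cancel_right]

@[simp]
theorem commutatorHom_apply (x : Q) (hx : ∀ g, ⁅x, g⁆ ∈ Subgroup.center Q) (g : Q) :
    commutatorHom x hx g = ⁅x, g⁆ := rfl

theorem commutatorHom_range_le_center (x : Q) (hx : ∀ g, ⁅x, g⁆ ∈ Subgroup.center Q) :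
    (commutatorHom x hx).range ≤ Subgroup.center Q := by
  rintro _ ⟨g, rfl⟩
  exact hx g

theorem commutatorHom_commutator (x : Q) (hx : ∀ g, ⁅x, g⁆ ∈ Subgroup.center Q) (g h : Q) :
    commutatorHom x hx ⁅g, h⁆ = 1 := by
  rw [map_commutatorElement, commutatorElement_eq_one_iff_mul_comm]
  exact (Subgroup.mem_center_iff.1 (hx g) _).symm

/-- The normal closure of an element `x` all of whose commutators are central: it is generated by
`x` together with the commutators `⁅x, g⁆`. -/
theorem zpowers_sup_commutatorHom_range_normal (x : Q)
    (hx : ∀ g, ⁅x, g⁆ ∈ Subgroup.center Q) :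
    (Subgroup.zpowers x ⊔ (commutatorHom x hx).range).Normal := by
  have hcen := commutatorHom_range_le_center x hx
  have : (commutatorHom x hx).range.Normal := by
    refine ⟨fun n hn g => ?_⟩
    rwa [Subgroup.mem_center_iff.1 (hcen hn) g, mul_inv_cancel_right]
  refine ⟨fun k hk g => ?_⟩
  obtain ⟨a, ha, b, hb, rfl⟩ := Subgroup.mem_sup_of_normal_right.1 hk
  obtain ⟨z, rfl⟩ := Subgroup.mem_zpowers_iff.1 ha
  have hgx : g * x * g⁻¹ ∈ Subgroup.zpowers x ⊔ (commutatorHom x hx).range := by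
    rw [show g * x * g⁻¹ = (commutatorHom x hx g)⁻¹ * x by simp [commutatorElement_def, mul_assoc]]
    exact mul_mem (inv_mem (Subgroup.mem_sup_right ⟨g, rfl⟩))
      (Subgroup.mem_sup_left (Subgroup.mem_zpowers x))
  rw [show g * (x ^ z * b) * g⁻¹ = (g * x * g⁻¹) ^ z * (g * b * g⁻¹) by rw [conj_zpow]; group]
  exact mul_mem (zpow_mem hgx z) (Subgroup.mem_sup_right (this.conj_mem b hb g))

theorem card_zpowers_sup_le [Finite Q] (x : Q) (R : Subgroup Q) [R.Normal] :
    Nat.card (Subgroup.zpowers x ⊔ R : Subgroup Q) ≤ orderOf x * Nat.card R := by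
  have h := Set.natCard_mul_le (s := (Subgroup.zpowers x : Set Q)) (t := (R : Set Q))
  rw [← Subgroup.mul_normal] at h
  exact h.trans_eq (congrArg (· * Nat.card R) (Nat.card_zpowers x))

end CommutatorHom

section LowerCentralCommutators

open scoped commutatorElement

variable {G : Type*} [Group G] [TopologicalSpace G] [IsTopologicalGroup G]

theorem isOpen_comap_mk' {N : Subgroup G} [N.Normal] (hN : IsOpen (N : Set G))
    (L : Subgroup (G ⧸ N)) : IsOpen (L.comap (QuotientGroup.mk' N) : Set G) := by
  refine Subgroup.isOpen_mono (H₁ := N) (fun x hx => ?_) hN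
  have : QuotientGroup.mk' N x = 1 := (QuotientGroup.eq_one_iff x).2 hx
  exact Subgroup.mem_comap.2 (this ▸ Subgroup.one_mem _)

theorem mk_mem_center_of_mem_lowerCentral {i : ℕ} {c : G} (hc : c ∈ lowerCentral G i) :
    (c : G ⧸ lowerCentral G (i + 1)) ∈ Subgroup.center (G ⧸ lowerCentral G (i + 1)) := by
  rw [Subgroup.mem_center_iff]
  intro g
  induction g using QuotientGroup.induction_on with | _ g => ?_
  refine (commutatorElement_eq_one_iff_mul_comm.1 ?_).symm
  exact (QuotientGroup.eq_one_iff ⁅c, g⁆).2 (commutatorElement_mem_lowerCentral hc g)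

theorem commutatorElement_mk_mem_center {i : ℕ} {x : G} (hx : x ∈ lowerCentral G i)
    (g : G ⧸ lowerCentral G (i + 2)) :
    ⁅(x : G ⧸ lowerCentral G (i + 2)), g⁆ ∈ Subgroup.center (G ⧸ lowerCentral G (i + 2)) := by
  induction g using QuotientGroup.induction_on with | _ g => ?_
  exact mk_mem_center_of_mem_lowerCentral (commutatorElement_mem_lowerCentral hx g)

theorem commutatorElement_mem_lowerCentral_of_mem_one {i : ℕ} {x : G}
    (hx : x ∈ lowerCentral G i) {g : G} (hg : g ∈ lowerCentral G 1) :
    ⁅x, g⁆ ∈ lowerCentral G (i + 2) := by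
  let φ := commutatorHom (x : G ⧸ lowerCentral G (i + 2)) (commutatorElement_mk_mem_center hx)
  have hmem : ∀ y : G, y ∈ φ.ker.comap (QuotientGroup.mk' _) ↔ ⁅x, y⁆ ∈ lowerCentral G (i + 2) :=
    fun y => QuotientGroup.eq_one_iff ⁅x, y⁆
  have hclosed : IsClosed (φ.ker.comap (QuotientGroup.mk' _) : Set G) := by
    have hcont : Continuous fun y : G => ⁅x, y⁆ := by
      simp only [commutatorElement_def]
      fun_prop
    convert (isClosed_lowerCentral (G := G) (i + 2)).preimage hcont using 1
    ext y
    exact hmem y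
  refine (hmem g).1 (lowerCentral_succ_le_of_isClosed hclosed (fun y _ h => ?_) hg)
  exact commutatorHom_commutator _ (commutatorElement_mk_mem_center hx) (y : G ⧸ _) (h : G ⧸ _)

/-- The exponent of `γ_{i+1} / γ_{i+2}` divides that of the abelianisation, because
`⁅x, g⁆ ^ m` is congruent to `⁅x, g ^ m⁆`. -/
theorem pow_mem_lowerCentral_succ {m : ℕ} (hm : ∀ g : G, g ^ m ∈ lowerCentral G 1) {i : ℕ} {y : G}
    (hy : y ∈ lowerCentral G i) : y ^ m ∈ lowerCentral G (i + 1) := by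
  cases i with
  | zero => exact hm y
  | succ i =>
    let Q := G ⧸ lowerCentral G (i + 2)
    -- the elements of the centre of the quotient that are killed by `m`
    let L : Subgroup Q :=
      { carrier := {q | q ∈ Subgroup.center Q ∧ q ^ m = 1}
        one_mem' := ⟨one_mem _, one_pow m⟩
        mul_mem' := fun {a b} ha hb => ⟨mul_mem ha.1 hb.1, by
          rw [Commute.mul_pow (Subgroup.mem_center_iff.1 hb.1 a), ha.2, hb.2, one_mul]⟩
        inv_mem' := fun {a} ha => ⟨inv_mem ha.1, by rw [inv_pow, ha.2, inv_one]⟩ }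
    have hclosed : IsClosed (L.comap (QuotientGroup.mk' _) : Set G) := by
      have hcont : ∀ g : G, Continuous fun y : G => ⁅y, g⁆ := fun g => by
        simp only [commutatorElement_def]
        fun_prop
      have hN := isClosed_lowerCentral (G := G) (i + 2)
      convert (isClosed_iInter fun g => hN.preimage (hcont g)).inter
        (hN.preimage (continuous_pow m)) using 1
      ext y
      simp only [Set.mem_inter_iff, Set.mem_iInter, Set.mem_preimage, SetLike.mem_coe]
      refine and_congr ?_ (QuotientGroup.eq_one_iff (y ^ m))
      refine Subgroup.mem_center_iff.trans ⟨fun h g => ?_, fun h q => ?_⟩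
      · exact (QuotientGroup.eq_one_iff ⁅y, g⁆).1
          (commutatorElement_eq_one_iff_mul_comm.2 (h (g : Q)).symm)
      · induction q using QuotientGroup.induction_on with | _ g => ?_
        exact (commutatorElement_eq_one_iff_mul_comm.1
          ((QuotientGroup.eq_one_iff ⁅y, g⁆).2 (h g))).symm
    have hL : lowerCentral G (i + 1) ≤ L.comap (QuotientGroup.mk' _) := by
      refine lowerCentral_succ_le_of_isClosed hclosed fun x hx g => ?_
      refine ⟨mk_mem_center_of_mem_lowerCentral (commutatorElement_mem_lowerCentral hx g), ?_⟩
      have h := (QuotientGroup.eq_one_iff ⁅x, g ^ m⁆).2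
        (commutatorElement_mem_lowerCentral_of_mem_one hx (hm g))
      exact (map_pow (commutatorHom (x : Q) (commutatorElement_mk_mem_center hx)) (g : Q)
        m).symm.trans h
    exact (QuotientGroup.eq_one_iff (y ^ m)).1 (hL hy).2

/-- If the abelianisation is cyclic, then the quotient by `γ_3` has a central subgroup with cyclic
quotient and is therefore commutative. -/
theorem lowerCentral_one_le_two_of_isCyclic
    [IsCyclic (G ⧸ lowerCentral G 1)] : lowerCentral G 1 ≤ lowerCentral G 2 := by
  let f : G ⧸ lowerCentral G 2 →* G ⧸ lowerCentral G 1 :=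
    QuotientGroup.map _ _ (MonoidHom.id G) (lowerCentral_succ_le 1)
  have hf : f.ker ≤ Subgroup.center _ := by
    intro q hq
    induction q using QuotientGroup.induction_on with | _ g => ?_
    exact mk_mem_center_of_mem_lowerCentral ((QuotientGroup.eq_one_iff g).1 hq)
  have hcomm := (f.isMulCommutative_of_isCyclic_of_ker_le_center hf).is_comm.comm
  refine lowerCentral_succ_le_of_isClosed (isClosed_lowerCentral 2) fun x _ g => ?_
  refine (QuotientGroup.eq_one_iff ⁅x, g⁆).1 ?_
  exact commutatorElement_eq_one_iff_mul_comm.2 (hcomm (x : G ⧸ lowerCentral G 2) g)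

theorem lowerCentral_le_of_one_le_two (h : lowerCentral G 1 ≤ lowerCentral G 2) (i : ℕ) :
    lowerCentral G 1 ≤ lowerCentral G (i + 1) := by
  induction i with
  | zero => exact le_rfl
  | succ i ih =>
    exact h.trans (lowerCentral_succ_le_of_isClosed (isClosed_lowerCentral _)
      fun x hx g => commutatorElement_mem_lowerCentral (ih hx) g)

variable [CompactSpace G] [TotallyDisconnectedSpace G]

/-- The normal closure `K` of an element of `γ_i` outside `γ_{i+1}` contains the oblique core of
`γ_{i+1}`, and modulo `γ_{i+2}` it has bounded order: it is generated by one element of bounded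
order and by a homomorphic image of the abelianisation. -/
theorem relIndex_lowerCentral_succ_le (ho : LowerCentralOpen G) {B : ℕ} {i : ℕ}
    (hB : (obliqueCore (lowerCentral G (i + 1))).relIndex (lowerCentral G (i + 1)) ≠ 0)
    (hB' : (obliqueCore (lowerCentral G (i + 1))).relIndex (lowerCentral G (i + 1)) ≤ B)
    {x : G} (hx : x ∈ lowerCentral G i) (hx' : x ∉ lowerCentral G (i + 1)) :
    (lowerCentral G (i + 2)).relIndex (lowerCentral G (i + 1)) ≤
      (lowerCentral G 1).index ^ 2 * (lowerCentral G 1).index * B := by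
  set m := (lowerCentral G 1).index with hm
  set N := lowerCentral G (i + 2) with hN
  have hm0 : m ≠ 0 := index_ne_zero_of_isOpen (ho 1)
  have hNfin : Finite (G ⧸ N) := N.quotient_finite_of_isOpen (ho _)
  have hpow : ∀ g : G, g ^ m ∈ lowerCentral G 1 := fun g => Subgroup.pow_index_mem _ g
  set φ := commutatorHom (x : G ⧸ N) (commutatorElement_mk_mem_center hx) with hφ
  have hKn := zpowers_sup_commutatorHom_range_normal (x : G ⧸ N)
    (commutatorElement_mk_mem_center hx)
  have hRn : φ.range.Normal := by
    refine ⟨fun n hn g => ?_⟩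
    rwa [Subgroup.mem_center_iff.1 (commutatorHom_range_le_center _ _ hn) g, mul_inv_cancel_right]
  rw [← hφ] at hKn
  set K' := Subgroup.zpowers (x : G ⧸ N) ⊔ φ.range with hK'
  have hord : orderOf (x : G ⧸ N) ≤ m ^ 2 := by
    refine orderOf_le_of_pow_eq_one (by positivity) ((QuotientGroup.eq_one_iff (x ^ m ^ 2)).2 ?_)
    rw [sq, pow_mul]
    exact pow_mem_lowerCentral_succ hpow (pow_mem_lowerCentral_succ hpow hx)
  have hrange : Nat.card φ.range ≤ m := by
    have hle : lowerCentral G 1 ≤ φ.ker.comap (QuotientGroup.mk' N) := fun g hg =>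
      (QuotientGroup.eq_one_iff ⁅x, g⁆).2 (commutatorElement_mem_lowerCentral_of_mem_one hx hg)
    have : (lowerCentral G 1).FiniteIndex := ⟨hm0⟩
    rw [← Subgroup.index_ker,
      ← Subgroup.index_comap_of_surjective φ.ker (QuotientGroup.mk'_surjective N)]
    exact Subgroup.index_antitone hle
  have hcard : Nat.card K' ≤ m ^ 2 * m :=
    (card_zpowers_sup_le _ _).trans (Nat.mul_le_mul hord hrange)
  set K := K'.comap (QuotientGroup.mk' N) with hK
  have hNK : N.relIndex K = Nat.card K' := by
    have h := Subgroup.relIndex_ker K (QuotientGroup.mk' N)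
    rwa [QuotientGroup.ker_mk', hK,
      Subgroup.map_comap_eq_self_of_surjective (QuotientGroup.mk'_surjective N)] at h
  have hxK : x ∈ K := Subgroup.mem_sup_left (Subgroup.mem_zpowers _)
  have hOK : obliqueCore (lowerCentral G (i + 1)) ≤ K :=
    obliqueCore_le_of_not_le (hKn.comap _)
      (Subgroup.isClosed_of_isOpen _ (isOpen_comap_mk' (ho _) _)) fun h => hx' (h hxK)
  have hNK' : N ≤ K := by
    have := Subgroup.ker_le_comap (QuotientGroup.mk' N) K'
    rwa [QuotientGroup.ker_mk'] at this
  rw [← Subgroup.relIndex_mul_relIndex N (K ⊓ lowerCentral G (i + 1)) _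
    (le_inf hNK' (lowerCentral_succ_le _)) inf_le_right]
  refine Nat.mul_le_mul ?_ ?_
  · refine (Subgroup.relIndex_le_of_le_right inf_le_left ?_).trans (hNK.trans_le hcard)
    rw [hNK]
    exact Nat.card_pos.ne'
  · exact (Subgroup.relIndex_le_of_le_left (le_inf hOK (obliqueCore_le_self _)) hB).trans hB'

end LowerCentralCommutators

/-! ### The lower central series of a pro-`p` group -/

section NilpotentDescent

theorem lowerCentralSeries_eq_bot_of_card_le {Q : Type*} [Group Q] [Finite Q]
    [hQ : Group.IsNilpotent Q] : ∀ B i : ℕ,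
      Nat.card ((⊤ : Subgroup Q).lowerCentralSeries i) ≤ B →
        (⊤ : Subgroup Q).lowerCentralSeries (i + B) = ⊥
  | 0, i, h => absurd h (Nat.not_le.2 Nat.card_pos)
  | B + 1, i, h => by
    let s := (⊤ : Subgroup Q).lowerCentralSeries
    have hle : s (i + 1) ≤ s i := Subgroup.lowerCentralSeries_antitone _ (Nat.le_succ i)
    by_cases heq : s (i + 1) = s i
    · obtain ⟨n, hn⟩ := Subgroup.nilpotent_iff_lowerCentralSeries.1 hQ
      have key : ∀ k, s i ≤ s k := by
        intro k
        induction k with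
        | zero => exact le_top
        | succ k ih => exact heq.ge.trans (Subgroup.commutator_mono ih le_rfl)
      have hbot : s i = ⊥ := le_bot_iff.1 (hn ▸ key n)
      exact le_bot_iff.1 (hbot ▸ Subgroup.lowerCentralSeries_antitone _ (Nat.le_add_right i _))
    · have hlt : Nat.card (s (i + 1)) < Nat.card (s i) := by
        by_contra hcon
        exact heq (Subgroup.eq_of_le_of_card_ge hle (not_lt.1 hcon))
      have := lowerCentralSeries_eq_bot_of_card_le (Q := Q) B (i + 1)
        (Nat.le_of_lt_succ (hlt.trans_le h))
      rwa [add_assoc, add_comm 1 B] at this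

end NilpotentDescent

/-- A subgroup that is not contained in all terms of the lower central series leaves it at a
definite step. -/
theorem exists_le_lowerCentral_not_le_succ {G : Type*} [Group G] [TopologicalSpace G]
    [IsTopologicalGroup G] {M : Subgroup G}
    (h : ∃ i, ¬ M ≤ lowerCentral G i) :
    ∃ i, M ≤ lowerCentral G i ∧ ¬ M ≤ lowerCentral G (i + 1) := by
  classical
  obtain ⟨i, hi⟩ : ∃ i, Nat.find h = i + 1 :=
    Nat.exists_eq_succ_of_ne_zero fun h0 => by
      have := Nat.find_spec h
      rw [h0] at this
      exact this le_top
  refine ⟨i, not_not.1 (Nat.find_min h (by omega)), ?_⟩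
  have := Nat.find_spec h
  rwa [hi] at this

section ProP

variable {p : ℕ} {G : Type*} [Group G] [TopologicalSpace G]
  [IsTopologicalGroup G] [CompactSpace G] [T2Space G] [TotallyDisconnectedSpace G]

theorem IsProP.exists_index_eq_pow (hG : IsProP p G) {N : Subgroup G} (hN : N.Normal)
    (ho : IsOpen (N : Set G)) : ∃ k : ℕ, N.index = p ^ k := by
  obtain ⟨k, hk⟩ := hG N hN ho
  rw [eindex_eq_index (index_ne_zero_of_isOpen ho)] at hk
  exact ⟨k, by exact_mod_cast hk⟩

theorem IsProP.isPGroup_quotient (hG : IsProP p G) {N : Subgroup G} [hN : N.Normal]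
    (ho : IsOpen (N : Set G)) : IsPGroup p (G ⧸ N) := by
  obtain ⟨k, hk⟩ := hG.exists_index_eq_pow hN ho
  exact IsPGroup.of_card hk

variable [Fact p.Prime]

/-- The lower central series descends strictly modulo an open normal subgroup `O` until it lies
in `O`. -/
theorem IsProP.lowerCentral_le_of_relIndex_le (hG : IsProP p G) {O : Subgroup G} [O.Normal]
    (ho : IsOpen (O : Set G)) {B i : ℕ} (h : O.relIndex (lowerCentral G i) ≤ B) :
    lowerCentral G (i + B) ≤ O := by
  have : Finite (G ⧸ O) := O.quotient_finite_of_isOpen ho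
  have : Group.IsNilpotent (G ⧸ O) := (hG.isPGroup_quotient ho).isNilpotent
  have hcard := Subgroup.relIndex_ker (lowerCentral G i) (QuotientGroup.mk' O)
  rw [QuotientGroup.ker_mk', map_mk'_lowerCentral ho] at hcard
  have hbot := lowerCentralSeries_eq_bot_of_card_le B i (hcard ▸ h)
  rw [← map_mk'_lowerCentral ho, Subgroup.map_eq_bot_iff, QuotientGroup.ker_mk'] at hbot
  exact hbot

theorem IsProP.lowerCentral_le_of_index_le (hG : IsProP p G) {O : Subgroup G} [O.Normal]
    (ho : IsOpen (O : Set G)) {B : ℕ} (h : O.index ≤ B) : lowerCentral G B ≤ O := by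
  have := hG.lowerCentral_le_of_relIndex_le ho (i := 0) (B := B)
    ((Subgroup.relIndex_top_right O).trans_le h)
  rwa [zero_add] at this

theorem IsProP.exists_notMem_lowerCentral (hG : IsProP p G) {x : G} (hx : x ≠ 1) :
    ∃ i, x ∉ lowerCentral G i := by
  obtain ⟨U, hUn, hUo, hxU⟩ := exists_open_normal_notMem hx
  exact ⟨U.index, fun h => hxU (hG.lowerCentral_le_of_index_le hUo le_rfl h)⟩

end ProP

/-! ### Obliquity -/

theorem LowerCentralWidthLE.relIndex_add_le {p : ℕ} {G : Type*} [Group G] [TopologicalSpace G]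
    [IsTopologicalGroup G] {w : ℕ} (hw : LowerCentralWidthLE p G w) (i t : ℕ) :
    (lowerCentral G (i + t)).relIndex (lowerCentral G i) ≠ 0 ∧
      (lowerCentral G (i + t)).relIndex (lowerCentral G i) ≤ p ^ (w * t) := by
  induction t with
  | zero => simp
  | succ t ih =>
    have h := hw (i + t)
    rw [← Nat.cast_pow, erelIndex_le_natCast] at h
    rw [← Subgroup.relIndex_mul_relIndex (lowerCentral G (i + (t + 1))) (lowerCentral G (i + t)) _
      (lowerCentral_succ_le _) (lowerCentral_antitone (Nat.le_add_right i t)), mul_add_one,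
      pow_add, mul_comm (p ^ (w * t))]
    exact ⟨mul_ne_zero h.1 ih.1, Nat.mul_le_mul h.2 ih.2⟩

section Obliquity

variable {p : ℕ} [hp : Fact p.Prime] {G : Type*} [Group G] [TopologicalSpace G]
  [IsTopologicalGroup G]

theorem ithObliquity_le_coe_iff {i : ℕ} {o : ℝ} :
    ithObliquity p G i ≤ (o : EReal) ↔
      (erelIndex (lowerCentral G i) (obliqueCore (lowerCentral G i)) : ℝ≥0∞) ≤
        (p : ℝ≥0∞) ^ o := by
  have hlog : 0 < Real.log p := Real.log_pos (by exact_mod_cast hp.out.one_lt)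
  have hp' : ENNReal.log (p : ℝ≥0∞) = ((Real.log p : ℝ) : EReal) := by
    rw [ENNReal.log_pos_real (by exact_mod_cast hp.out.ne_zero) (ENNReal.natCast_ne_top p),
      ENNReal.toReal_natCast]
  rw [ithObliquity, EReal.div_le_iff_le_mul (by exact_mod_cast hlog) (EReal.coe_ne_top _),
    ← ENNReal.log_le_log_iff, ENNReal.log_rpow, hp', mul_comm]

theorem erelIndex_obliqueCore_le {o : ℝ} (ho : obliquity p G ≤ (o : EReal)) (i : ℕ) :
    (erelIndex (lowerCentral G i) (obliqueCore (lowerCentral G i)) : ℝ≥0∞) ≤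
      (p : ℝ≥0∞) ^ o :=
  ithObliquity_le_coe_iff.1 ((le_iSup (ithObliquity p G) i).trans ho)

/-- Finite obliquity bounds the indices of the oblique cores of the terms of the lower central
series by an integer. -/
theorem HasFiniteObliquity.exists_relIndex_le (h : HasFiniteObliquity p G) :
    ∃ B : ℕ, ∀ i, (obliqueCore (lowerCentral G i)).relIndex (lowerCentral G i) ≠ 0 ∧
      (obliqueCore (lowerCentral G i)).relIndex (lowerCentral G i) ≤ B := by
  obtain ⟨o, ho, -⟩ := EReal.lt_iff_exists_real_btwn.1 h.2
  obtain ⟨b, hb⟩ := exists_nat_ge o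
  refine ⟨p ^ b, fun i => erelIndex_le_natCast.1 ?_⟩
  have h1 : (p : ℝ≥0∞) ^ o ≤ (p : ℝ≥0∞) ^ (b : ℝ) :=
    ENNReal.rpow_le_rpow_of_exponent_le (by exact_mod_cast hp.out.one_lt.le) hb
  have h2 := (erelIndex_obliqueCore_le ho.le i).trans h1
  rw [ENNReal.rpow_natCast] at h2
  rw [← ENat.toENNReal_le]
  simpa using h2

theorem IsOpen.lowerCentral_obliqueCore [CompactSpace G] (ho : LowerCentralOpen G) {i : ℕ}
    (h : (obliqueCore (lowerCentral G i)).relIndex (lowerCentral G i) ≠ 0) :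
    IsOpen (obliqueCore (lowerCentral G i) : Set G) :=
  isOpen_of_relIndex_ne_zero (isClosed_obliqueCore (isClosed_lowerCentral i)) (ho i)
    (obliqueCore_le_self _) h

theorem HasFiniteObliquity.exists_lowerCentralWidthLE [CompactSpace G]
    [TotallyDisconnectedSpace G] (h : HasFiniteObliquity p G) :
    ∃ w : ℕ, LowerCentralWidthLE p G w := by
  obtain ⟨B, hB⟩ := h.exists_relIndex_le
  set m := (lowerCentral G 1).index with hm
  have hm0 : m ≠ 0 := index_ne_zero_of_isOpen (h.1 1)
  have hB0 : 0 < B := (Nat.pos_of_ne_zero (hB 0).1).trans_le (hB 0).2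
  have hle : m ^ 2 * m * B ≤ p ^ (m ^ 2 * m * B) := (Nat.lt_pow_self hp.out.one_lt).le
  refine ⟨m ^ 2 * m * B, fun i => ?_⟩
  have hne : (lowerCentral G (i + 1)).relIndex (lowerCentral G i) ≠ 0 := by
    have := Subgroup.relIndex_mul_index (lowerCentral_succ_le (G := G) i)
    intro h0
    rw [h0, zero_mul] at this
    exact index_ne_zero_of_isOpen (h.1 _) this.symm
  rw [← Nat.cast_pow, erelIndex_le_natCast]
  refine ⟨hne, le_trans ?_ hle⟩
  cases i with
  | zero =>
    refine (Subgroup.relIndex_top_right _).trans_le ?_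
    rw [← hm]
    calc m = 1 * m * 1 := by ring
      _ ≤ m ^ 2 * m * B := by
        gcongr
        · exact Nat.one_le_iff_ne_zero.2 (pow_ne_zero 2 hm0)
        · exact hB0
  | succ i =>
    by_cases hx : lowerCentral G i ≤ lowerCentral G (i + 1)
    · -- the series is stationary from `γ_i` on
      have : lowerCentral G (i + 1) ≤ lowerCentral G (i + 2) :=
        lowerCentral_succ_le_of_isClosed (isClosed_lowerCentral _)
          fun x hx' g => commutatorElement_mem_lowerCentral (hx hx') g
      rw [Subgroup.relIndex_eq_one.2 this]
      exact Nat.one_le_iff_ne_zero.2 (by positivity)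
    · obtain ⟨x, hx, hx'⟩ := SetLike.not_le_iff_exists.1 hx
      exact relIndex_lowerCentral_succ_le h.1 (hB _).1 (hB _).2 hx hx'

/-- If `M` lies in `γ_j` but not in `γ_{j+1}`, then `M` contains the oblique core of `γ_{j+1}`,
while a subgroup `N` not containing `M` must lie in `γ_{j-B}`: otherwise it would contain the
oblique core of `γ_{j-B}`, hence `γ_j`. -/
theorem HasFiniteObliquity.exists_normalIntersectionLE [CompactSpace G] [T2Space G]
    [TotallyDisconnectedSpace G] (hG : IsProP p G) (h : HasFiniteObliquity p G) :
    ∃ c : ℕ, NormalIntersectionLE p G c := by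
  obtain ⟨B, hB⟩ := h.exists_relIndex_le
  obtain ⟨w, hw⟩ := h.exists_lowerCentralWidthLE
  refine ⟨w * (B + 1) + B, fun N M hN hNc hM hMc hMN => ?_⟩
  obtain ⟨x, hxM, hxN⟩ := SetLike.not_le_iff_exists.1 hMN
  have hx1 : x ≠ 1 := fun h1 => hxN (h1 ▸ one_mem N)
  obtain ⟨k, hk⟩ := hG.exists_notMem_lowerCentral hx1
  obtain ⟨j, hj, hj'⟩ := exists_le_lowerCentral_not_le_succ ⟨k, fun hle => hk (hle hxM)⟩
  have hOM := obliqueCore_le_of_not_le hM hMc hj'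
  have hNle : N ≤ lowerCentral G (j - B) := by
    by_contra hcon
    have hON := obliqueCore_le_of_not_le hN hNc hcon
    have hjB : B ≤ j := by
      by_contra hlt
      rw [Nat.sub_eq_zero_of_le (not_le.1 hlt).le] at hcon
      exact hcon le_top
    have := obliqueCore_normal (lowerCentral_normal (G := G) (j - B))
    have hle := hG.lowerCentral_le_of_relIndex_le
      (IsOpen.lowerCentral_obliqueCore h.1 (hB (j - B)).1) (hB (j - B)).2
    rw [Nat.sub_add_cancel hjB] at hle
    exact hMN (hj.trans (hle.trans hON))
  obtain ⟨t, ht, ht'⟩ : ∃ t, t ≤ B + 1 ∧ j + 1 = (j - B) + t :=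
    ⟨j + 1 - (j - B), by omega, by omega⟩
  have hO : (obliqueCore (lowerCentral G (j + 1))).relIndex (lowerCentral G (j - B)) ≠ 0 ∧
      (obliqueCore (lowerCentral G (j + 1))).relIndex (lowerCentral G (j - B)) ≤
        p ^ (w * (B + 1) + B) := by
    have h1 := hw.relIndex_add_le (j - B) t
    rw [← ht'] at h1
    rw [← Subgroup.relIndex_mul_relIndex _ _ _ (obliqueCore_le_self (lowerCentral G (j + 1)))
      (lowerCentral_antitone (show j - B ≤ j + 1 by omega)), pow_add, mul_comm]
    refine ⟨mul_ne_zero h1.1 (hB _).1, Nat.mul_le_mul (h1.2.trans ?_)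
      ((hB _).2.trans (Nat.lt_pow_self hp.out.one_lt).le)⟩
    exact Nat.pow_le_pow_right hp.out.pos (Nat.mul_le_mul_left w ht)
  have h1 := Subgroup.relIndex_le_of_le_left hOM hO.1
  have h1' : M.relIndex (lowerCentral G (j - B)) ≠ 0 := fun h0 =>
    hO.1 (Subgroup.relIndex_eq_zero_of_le_left hOM h0)
  rw [← Nat.cast_pow, erelIndex_le_natCast]
  refine ⟨fun h0 => h1' (Subgroup.relIndex_eq_zero_of_le_right hNle h0), ?_⟩
  exact (Subgroup.relIndex_le_of_le_right hNle h1').trans (h1.trans hO.2)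

end Obliquity

/-! ### Groups whose open normal subgroups form a chain -/

section Chain

/-- The open normal subgroups of `G` are totally ordered by inclusion. -/
def OpenNormalChain (G : Type*) [Group G] [TopologicalSpace G] : Prop :=
  ∀ A B : Subgroup G, A.Normal → IsOpen (A : Set G) → B.Normal → IsOpen (B : Set G) →
    A ≤ B ∨ B ≤ A

theorem OpenNormalChain.obliqueCore_eq {G : Type*} [Group G] [TopologicalSpace G]
    (h : OpenNormalChain G) {K : Subgroup G} (hK : K.Normal) (hKo : IsOpen (K : Set G)) :
    obliqueCore K = K :=
  inf_eq_left.2 (le_sInf fun _ hL => (h _ _ hK hKo hL.1 hL.2.1).resolve_right hL.2.2)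

theorem OpenNormalChain.exists_obFun_eq {G : Type*} [Group G] [TopologicalSpace G]
    [IsTopologicalGroup G] [CompactSpace G] (h : OpenNormalChain G) {n : ℕ} (hn : 1 ≤ n) :
    ∃ K : Subgroup G, K.Normal ∧ IsOpen (K : Set G) ∧ K.index ≤ n ∧
      normalIndexCore G n = K ∧ obFun G n = K.index := by
  classical
  let P : ℕ → Prop := fun m => ∃ K : Subgroup G, K.Normal ∧ IsOpen (K : Set G) ∧ K.index = m
  have h1 : P 1 := ⟨⊤, inferInstance, isOpen_univ, Subgroup.index_top⟩
  obtain ⟨K, hK, hKo, hKi⟩ := Nat.findGreatest_spec hn h1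
  have hKn : K.index ≤ n := hKi.trans_le (Nat.findGreatest_le n)
  have hK0 := index_ne_zero_of_isOpen hKo
  have hcore : normalIndexCore G n = K := by
    refine le_antisymm (normalIndexCore_le hK hKo (eindex_le_natCast.2 ⟨hK0, hKn⟩))
      (le_sInf fun L hL => ?_)
    by_contra hcon
    -- otherwise `L` is a proper subgroup of `K`, of larger index
    have hLK : L ≤ K := (h _ _ hK hKo hL.1 hL.2.1).resolve_left hcon
    have hL' := eindex_le_natCast.1 hL.2.2
    have h2 := index_lt_of_lt_of_index_ne_zero (lt_of_le_not_ge hLK hcon) hL'.1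
    have h3 := Nat.le_findGreatest hL'.2 (show P L.index from ⟨L, hL.1, hL.2.1, rfl⟩)
    omega
  refine ⟨K, hK, hKo, hKn, hcore, ?_⟩
  rw [obFun, hcore, h.obliqueCore_eq hK hKo, eindex_eq_index hK0]

theorem OpenNormalChain.obFun_le {G : Type*} [Group G] [TopologicalSpace G]
    [IsTopologicalGroup G] [CompactSpace G] (h : OpenNormalChain G) {n : ℕ} (hn : 1 ≤ n) :
    obFun G n ≤ n := by
  obtain ⟨K, -, -, hKn, -, hK⟩ := h.exists_obFun_eq hn
  rw [hK]
  exact_mod_cast hKn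

theorem OpenNormalChain.of_continuousMulEquiv {G G' : Type*} [Group G] [TopologicalSpace G]
    [Group G'] [TopologicalSpace G'] (h : OpenNormalChain G') (e : G ≃ₜ* G') :
    OpenNormalChain G := by
  intro A B hA hAo hB hBo
  have hle : ∀ A B : Subgroup G, A.comap (e.symm : G' →* G) ≤ B.comap (e.symm : G' →* G) →
      A ≤ B := by
    intro A B hAB x hx
    have := @hAB (e x) (by simpa using hx)
    simpa using this
  exact (h _ _ (hA.comap (e.symm : G' →* G)) (hAo.preimage e.symm.continuous)
    (hB.comap (e.symm : G' →* G)) (hBo.preimage e.symm.continuous)).imp (hle A B) (hle B A)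

theorem IsCyclic.le_of_card_dvd {G : Type*} [Group G] [Finite G] [IsCyclic G] {A B : Subgroup G}
    (h : Nat.card A ∣ Nat.card B) : A ≤ B := by
  classical
  have := Fintype.ofFinite G
  -- `B` is the set of solutions of `x ^ |B| = 1`
  have hsub : (Finset.univ.filter fun x => x ∈ B) ⊆
      (Finset.univ.filter fun x : G => x ^ Nat.card B = 1) := by
    intro x hx
    simp only [Finset.mem_filter, Finset.mem_univ, true_and] at hx ⊢
    exact orderOf_dvd_iff_pow_eq_one.1 (B.orderOf_dvd_natCard hx)
  have hcard : (Finset.univ.filter fun x => x ∈ B).card = Nat.card B := by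
    rw [Nat.card_eq_fintype_card, Fintype.card_subtype]
  have heq := Finset.eq_of_subset_of_card_le hsub
    ((IsCyclic.card_pow_eq_one_le Nat.card_pos).trans hcard.ge)
  intro a ha
  have : a ∈ Finset.univ.filter fun x : G => x ^ Nat.card B = 1 := by
    simp only [Finset.mem_filter, Finset.mem_univ, true_and]
    exact orderOf_dvd_iff_pow_eq_one.1 ((A.orderOf_dvd_natCard ha).trans h)
  rw [← heq] at this
  exact (Finset.mem_filter.1 this).2

theorem IsPGroup.openNormalChain_of_isCyclic {p : ℕ} [Fact p.Prime] {G : Type*} [Group G]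
    [TopologicalSpace G] [Finite G] [IsCyclic G] (hG : IsPGroup p G) : OpenNormalChain G := by
  intro A B _ _ _ _
  obtain ⟨a, ha⟩ := IsPGroup.iff_card.1 (hG.to_subgroup A)
  obtain ⟨b, hb⟩ := IsPGroup.iff_card.1 (hG.to_subgroup B)
  rcases le_total a b with h | h
  · exact Or.inl (IsCyclic.le_of_card_dvd (ha ▸ hb ▸ pow_dvd_pow p h))
  · exact Or.inr (IsCyclic.le_of_card_dvd (ha ▸ hb ▸ pow_dvd_pow p h))

end Chain

/-! ### The `p`-adic integers -/

section PadicInt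

variable (p : ℕ) [hp : Fact p.Prime]

/-- The subgroup `p ^ k ℤ_p` of `ℤ_p`, written multiplicatively. -/
noncomputable def padicPowSubgroup (k : ℕ) : Subgroup (Multiplicative ℤ_[p]) :=
  (AddMonoidHom.toMultiplicative (PadicInt.toZModPow (p := p) k).toAddMonoidHom).ker

variable {p}

theorem mem_padicPowSubgroup {k : ℕ} {x : Multiplicative ℤ_[p]} :
    x ∈ padicPowSubgroup p k ↔ ‖x.toAdd‖ ≤ (p : ℝ) ^ (-k : ℤ) := by
  rw [PadicInt.norm_le_pow_iff_mem_span_pow, ← PadicInt.ker_toZModPow, RingHom.mem_ker]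
  rfl

theorem isOpen_padicPowSubgroup (k : ℕ) :
    IsOpen (padicPowSubgroup p k : Set (Multiplicative ℤ_[p])) := by
  have hpos : 0 < (p : ℝ) ^ (-k : ℤ) := zpow_pos (by exact_mod_cast hp.out.pos) _
  refine Subgroup.isOpen_of_mem_nhds _ (g := 1) ?_
  have h : Metric.ball (0 : ℤ_[p]) ((p : ℝ) ^ (-k : ℤ)) ∈ nhds (0 : ℤ_[p]) :=
    Metric.ball_mem_nhds _ hpos
  have h' : (fun x : Multiplicative ℤ_[p] => x.toAdd) ⁻¹'
      Metric.ball (0 : ℤ_[p]) ((p : ℝ) ^ (-k : ℤ)) ∈ nhds (1 : Multiplicative ℤ_[p]) :=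
    continuous_toAdd.continuousAt.preimage_mem_nhds h
  refine Filter.mem_of_superset h' fun x hx => mem_padicPowSubgroup.2 ?_
  exact (mem_ball_zero_iff.1 hx).le

theorem index_padicPowSubgroup (k : ℕ) : (padicPowSubgroup p k).index = p ^ k := by
  have hsurj : Function.Surjective
      (AddMonoidHom.toMultiplicative (PadicInt.toZModPow (p := p) k).toAddMonoidHom) :=
    ZMod.ringHom_surjective (PadicInt.toZModPow (p := p) k)
  rw [padicPowSubgroup, Subgroup.index_ker, MonoidHom.range_eq_top.2 hsurj, Subgroup.card_top]
  exact Nat.card_zmod (p ^ k)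

theorem exists_padicPowSubgroup_le {U : Subgroup (Multiplicative ℤ_[p])}
    (hU : IsOpen (U : Set (Multiplicative ℤ_[p]))) : ∃ k, padicPowSubgroup p k ≤ U := by
  have h : Multiplicative.ofAdd ⁻¹' (U : Set (Multiplicative ℤ_[p])) ∈ nhds (0 : ℤ_[p]) :=
    (hU.preimage continuous_ofAdd).mem_nhds U.one_mem
  obtain ⟨ε, hε, hball⟩ := Metric.mem_nhds_iff.1 h
  obtain ⟨k, hk⟩ := PadicInt.exists_pow_neg_lt p hε
  exact ⟨k, fun x hx => @hball x.toAdd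
    (mem_ball_zero_iff.2 ((mem_padicPowSubgroup.1 hx).trans_lt hk))⟩

theorem exists_index_eq_pow_of_isOpen {U : Subgroup (Multiplicative ℤ_[p])}
    (hU : IsOpen (U : Set (Multiplicative ℤ_[p]))) : ∃ k, U.index = p ^ k := by
  obtain ⟨k, hk⟩ := exists_padicPowSubgroup_le hU
  have := Subgroup.index_dvd_of_le hk
  rw [index_padicPowSubgroup] at this
  obtain ⟨j, -, hj⟩ := (Nat.dvd_prime_pow hp.out).1 this
  exact ⟨j, hj⟩

/-- A closed subgroup of `ℤ_p` is an ideal, because `ℤ` is dense in `ℤ_p`. -/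
theorem ofAdd_mul_mem_of_isClosed {A : Subgroup (Multiplicative ℤ_[p])}
    (hA : IsClosed (A : Set (Multiplicative ℤ_[p]))) {a : ℤ_[p]}
    (ha : Multiplicative.ofAdd a ∈ A) (c : ℤ_[p]) : Multiplicative.ofAdd (c * a) ∈ A := by
  refine PadicInt.denseRange_intCast.induction_on
    (p := fun c => Multiplicative.ofAdd (c * a) ∈ A) c ?_ fun z => ?_
  · exact hA.preimage (continuous_ofAdd.comp (continuous_mul_const a))
  · rw [← zsmul_eq_mul, ofAdd_zsmul]
    exact zpow_mem ha z

theorem openNormalChain_padicInt : OpenNormalChain (Multiplicative ℤ_[p]) := by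
  intro A B _ hA _ hB
  by_contra! hcon
  obtain ⟨a, haA, haB⟩ := SetLike.not_le_iff_exists.1 hcon.1
  obtain ⟨b, hbB, hbA⟩ := SetLike.not_le_iff_exists.1 hcon.2
  rcases ValuationRing.dvd_total a.toAdd b.toAdd with ⟨c, hc⟩ | ⟨c, hc⟩
  · refine hbA ?_
    have := ofAdd_mul_mem_of_isClosed (A.isClosed_of_isOpen hA) (a := a.toAdd) haA c
    rwa [mul_comm, ← hc] at this
  · refine haB ?_
    have := ofAdd_mul_mem_of_isClosed (B.isClosed_of_isOpen hB) (a := b.toAdd) hbB c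
    rwa [mul_comm, ← hc] at this

theorem isGreatest_obFun_padicInt {n : ℕ} (hn : 1 ≤ n) :
    IsGreatest {m : ℕ∞ | ∃ k : ℕ, m = (p : ℕ∞) ^ k ∧ m ≤ (n : ℕ∞)}
      (obFun (Multiplicative ℤ_[p]) n) := by
  obtain ⟨K, -, hKo, hKn, hcore, hob⟩ := (openNormalChain_padicInt (p := p)).exists_obFun_eq hn
  obtain ⟨k, hk⟩ := exists_index_eq_pow_of_isOpen hKo
  rw [hob]
  refine ⟨⟨k, by rw [hk]; norm_cast, by exact_mod_cast hKn⟩, ?_⟩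
  rintro _ ⟨j, rfl, hj⟩
  have hle : K ≤ padicPowSubgroup p j := by
    rw [← hcore]
    refine normalIndexCore_le inferInstance (isOpen_padicPowSubgroup j) ?_
    rw [eindex_eq_index (index_ne_zero_of_isOpen (isOpen_padicPowSubgroup j)),
      index_padicPowSubgroup]
    exact_mod_cast hj
  have : K.FiniteIndex := ⟨index_ne_zero_of_isOpen hKo⟩
  have := Subgroup.index_antitone hle
  rw [index_padicPowSubgroup] at this
  exact_mod_cast this

end PadicInt

/-! ### The explicit bound for groups of finite obliquity -/

section Bound

variable {p : ℕ} [hp : Fact p.Prime] {G : Type*} [Group G] [TopologicalSpace G]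
  [IsTopologicalGroup G] [CompactSpace G] [T2Space G] [TotallyDisconnectedSpace G]

theorem IsProP.lowerCentral_one_eq_bot_of_isCyclic (hG : IsProP p G)
    [IsCyclic (G ⧸ lowerCentral G 1)] : lowerCentral G 1 = ⊥ := by
  rw [eq_bot_iff]
  intro x hx
  by_contra hx1
  obtain ⟨i, hi⟩ := hG.exists_notMem_lowerCentral hx1
  exact hi (lowerCentral_succ_le i
    (lowerCentral_le_of_one_le_two lowerCentral_one_le_two_of_isCyclic i hx))

/-- If the lower central series is open and `G / γ_2` is cyclic, then `γ_2 = 1`, so `G` is a finite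
cyclic group. -/
theorem IsProP.openNormalChain_of_isCyclic (hG : IsProP p G) (ho : LowerCentralOpen G)
    [IsCyclic (G ⧸ lowerCentral G 1)] : OpenNormalChain G := by
  have hbot := hG.lowerCentral_one_eq_bot_of_isCyclic
  have hinj : Function.Injective (QuotientGroup.mk' (lowerCentral G 1)) := by
    rw [← MonoidHom.ker_eq_bot_iff, QuotientGroup.ker_mk', hbot]
  have : Finite (G ⧸ lowerCentral G 1) := Subgroup.quotient_finite_of_isOpen _ (ho 1)
  have : Finite G := Finite.of_injective _ hinj
  have : IsCyclic G := isCyclic_of_injective _ hinj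
  exact ((hG.isPGroup_quotient (ho 1)).of_injective _ hinj).openNormalChain_of_isCyclic

/-- If `G / γ_2` has order at most `p ^ w` and is not cyclic, then its exponent divides
`p ^ (w - 1)`. -/
theorem IsProP.pow_mem_lowerCentral_one_of_not_isCyclic (hG : IsProP p G)
    (ho : LowerCentralOpen G) (hc : ¬ IsCyclic (G ⧸ lowerCentral G 1)) {w : ℕ}
    (hw : (lowerCentral G 1).index ≤ p ^ w) :
    2 ≤ w ∧ ∀ g : G, g ^ p ^ (w - 1) ∈ lowerCentral G 1 := by
  have hfin : Finite (G ⧸ lowerCentral G 1) := Subgroup.quotient_finite_of_isOpen _ (ho 1)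
  obtain ⟨a, ha⟩ := hG.exists_index_eq_pow (lowerCentral_normal 1) (ho 1)
  have hcard : Nat.card (G ⧸ lowerCentral G 1) = p ^ a := ha
  have haw : a ≤ w := (Nat.pow_le_pow_iff_right hp.out.one_lt).1 (ha ▸ hw)
  have ha2 : 2 ≤ a := by
    by_contra! hlt
    interval_cases a
    · have := (Nat.card_eq_one_iff_unique.1 (hcard.trans (pow_zero p))).1
      exact hc isCyclic_of_subsingleton
    · exact hc (isCyclic_of_prime_card (hcard.trans (pow_one p)))
  refine ⟨ha2.trans haw, fun g => (QuotientGroup.eq_one_iff (g ^ p ^ (w - 1))).1 ?_⟩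
  have hdvd := orderOf_dvd_natCard (g : G ⧸ lowerCentral G 1)
  rw [hcard] at hdvd
  obtain ⟨b, hba, hb⟩ := (Nat.dvd_prime_pow hp.out).1 hdvd
  have hne : b ≠ a := fun h => hc (isCyclic_of_orderOf_eq_card (g : G ⧸ lowerCentral G 1)
    (by rw [hb, hcard, h]))
  have hdvd' : orderOf (g : G ⧸ lowerCentral G 1) ∣ p ^ (w - 1) := by
    rw [hb]
    exact pow_dvd_pow p (by omega)
  exact orderOf_dvd_iff_pow_eq_one.1 hdvd'

/-- Let `K` be an open normal subgroup of index at most `p ^ n` that does not contain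
`z ∈ γ_i`. The index of `M = ⟨z⟩ γ_{i+1}` is bounded through the intersection `M ∩ K`, which has
index at most `p ^ c` in `K` and at least `p` in `M`. -/
theorem NormalIntersectionLE.index_lowerCentral_succ_mul_le {c n e i : ℕ}
    (hc : NormalIntersectionLE p G c) (hG : IsProP p G) (ho : LowerCentralOpen G)
    (he : ∀ g : G, g ^ p ^ e ∈ lowerCentral G 1) {K : Subgroup G} (hK : K.Normal)
    (hKo : IsOpen (K : Set G)) (hKn : K.index ≤ p ^ n) {z : G} (hz : z ∈ lowerCentral G i)
    (hzK : z ∉ K) : (lowerCentral G (i + 1)).index * p ≤ p ^ (n + c + e) := by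
  set N := lowerCentral G (i + 1) with hN
  set M := Subgroup.zpowers z ⊔ N with hM
  have hzM : z ∈ M := Subgroup.mem_sup_left (Subgroup.mem_zpowers z)
  have hMle : M ≤ lowerCentral G i :=
    sup_le ((Subgroup.zpowers_le).2 hz) (lowerCentral_succ_le i)
  have hMo : IsOpen (M : Set G) := Subgroup.isOpen_mono le_sup_right (ho (i + 1))
  have hMn : M.Normal := by
    refine ⟨fun x hx g => ?_⟩
    have h := commutatorElement_mem_lowerCentral (hMle hx) g
    rw [show g * x * g⁻¹ = (x * g * x⁻¹ * g⁻¹)⁻¹ * x by group]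
    exact mul_mem (Subgroup.mem_sup_right (inv_mem h)) hx
  have hMK0 : (M ⊓ K).index ≠ 0 := index_ne_zero_of_isOpen (by
    rw [Subgroup.coe_inf]; exact hMo.inter hKo)
  -- the index of `M ⊓ K`, computed through `K`
  have h1 : (M ⊓ K).index ≤ p ^ c * p ^ n := by
    have h := hc K M hK (K.isClosed_of_isOpen hKo) hMn (M.isClosed_of_isOpen hMo)
      fun hle => hzK (hle hzM)
    rw [← Nat.cast_pow, erelIndex_le_natCast] at h
    rw [← Subgroup.relIndex_mul_index (inf_le_right : M ⊓ K ≤ K), Subgroup.inf_relIndex_right]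
    exact Nat.mul_le_mul h.2 hKn
  -- and through `M`
  have h2 : p * M.index ≤ (M ⊓ K).index := by
    rw [← Subgroup.relIndex_mul_index (inf_le_left : M ⊓ K ≤ M)]
    refine Nat.mul_le_mul_right _ ?_
    obtain ⟨a, ha⟩ := hG.exists_index_eq_pow (N := M ⊓ K) inferInstance (by
      rw [Subgroup.coe_inf]; exact hMo.inter hKo)
    have hdvd := Subgroup.relIndex_dvd_index_of_le (inf_le_left : M ⊓ K ≤ M)
    rw [ha] at hdvd
    obtain ⟨b, -, hb⟩ := (Nat.dvd_prime_pow hp.out).1 hdvd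
    rw [hb]
    refine Nat.le_self_pow ?_ p
    rintro rfl
    exact hzK ((Subgroup.relIndex_eq_one.1 (hb.trans (pow_zero p)) hzM).2)
  have h3 : N.relIndex M ≤ p ^ e := by
    rw [hM, sup_comm, Subgroup.relIndex_sup_left]
    have h := Subgroup.relIndex_ker (Subgroup.zpowers z) (QuotientGroup.mk' N)
    rw [QuotientGroup.ker_mk', MonoidHom.map_zpowers, Nat.card_zpowers] at h
    rw [h]
    exact orderOf_le_of_pow_eq_one (pow_pos hp.out.pos e)
      ((QuotientGroup.eq_one_iff (z ^ p ^ e)).2 (pow_mem_lowerCentral_succ he hz))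
  calc N.index * p = N.relIndex M * (p * M.index) := by
        rw [← Subgroup.relIndex_mul_index (le_sup_right : N ≤ M)]; ring
    _ ≤ p ^ e * (p ^ c * p ^ n) := Nat.mul_le_mul h3 (h2.trans h1)
    _ = p ^ (n + c + e) := by ring

/-- The oblique core of `I_{p^n}(G)` contains that of the first `γ_{i+1}` contained in
`I_{p^n}(G)`. -/
theorem IsProP.exists_obFun_le (hG : IsProP p G) (h : HasFiniteObliquity p G)
    (hcard : (p : ℕ∞) < ENat.card G) {c w : ℕ} (hc : NormalIntersectionLE p G c)
    (hw : LowerCentralWidthLE p G w) (n : ℕ) :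
    ∃ d i : ℕ, d + 2 ≤ n + c + w ∧ obFun G (p ^ n) ≤
      (p : ℕ∞) ^ d * erelIndex (lowerCentral G i) (obliqueCore (lowerCentral G i)) := by
  have hB : ∀ i, erelIndex (lowerCentral G i) (obliqueCore (lowerCentral G i)) =
      ((obliqueCore (lowerCentral G i)).relIndex (lowerCentral G i) : ℕ∞) := fun i =>
    eindex_eq_index (h.exists_relIndex_le.choose_spec i).1
  have hB0 : ∀ i, (obliqueCore (lowerCentral G i)).relIndex (lowerCentral G i) ≠ 0 := fun i =>
    (h.exists_relIndex_le.choose_spec i).1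
  have hpn : 1 ≤ p ^ n := Nat.one_le_pow _ _ hp.out.pos
  have hw1 : (lowerCentral G 1).index ≤ p ^ w := by
    have := hw 0
    rw [← Nat.cast_pow, erelIndex_le_natCast] at this
    exact (Subgroup.relIndex_top_right _).ge.trans this.2
  by_cases hcyc : IsCyclic (G ⧸ lowerCentral G 1)
  · -- `G` is a finite cyclic group, and `ob_G (p ^ n) ≤ p ^ n`
    have hchain := hG.openNormalChain_of_isCyclic h.1
    have hbot := hG.lowerCentral_one_eq_bot_of_isCyclic
    have hw2 : 2 ≤ w := by
      rw [hbot, Subgroup.index_bot] at hw1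
      have hfin : Nat.card G ≠ 0 := by
        rw [← Subgroup.index_bot, ← hbot]
        exact index_ne_zero_of_isOpen (h.1 1)
      have := (Nat.card_ne_zero.1 hfin).2
      rw [ENat.card_eq_coe_natCard, Nat.cast_lt] at hcard
      refine (Nat.pow_lt_pow_iff_right hp.out.one_lt).1 ?_
      rw [pow_one]
      exact hcard.trans_le hw1
    refine ⟨n, 0, by omega, ?_⟩
    have hle := hchain.obFun_le hpn
    rw [Nat.cast_pow] at hle
    refine hle.trans (le_mul_of_one_le_right' ?_)
    rw [hB]
    exact_mod_cast Nat.one_le_iff_ne_zero.2 (hB0 0)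
  obtain ⟨hw2, hexp⟩ := hG.pow_mem_lowerCentral_one_of_not_isCyclic h.1 hcyc hw1
  set H := normalIndexCore G (p ^ n) with hH
  by_cases htop : H = ⊤
  · refine ⟨0, 0, by omega, ?_⟩
    rw [obFun, ← hH, htop, pow_zero, one_mul]
    refine le_of_eq ?_
    rw [hB 0, eindex_eq_index]
    · exact congrArg _ (Subgroup.relIndex_top_right _).symm
    · rw [← Subgroup.relIndex_top_right]
      exact hB0 0
  classical
  -- the first term of the lower central series inside `H`
  have hex : ∃ i, lowerCentral G i ≤ H := by
    refine ⟨p ^ n, le_sInf fun K hK => ?_⟩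
    have := hK.1
    exact hG.lowerCentral_le_of_index_le hK.2.1 (eindex_le_natCast.1 hK.2.2).2
  obtain ⟨i, hi⟩ : ∃ i, Nat.find hex = i + 1 :=
    Nat.exists_eq_succ_of_ne_zero fun h0 => by
      have := Nat.find_spec hex
      rw [h0] at this
      exact htop (top_le_iff.1 this)
  have hiH : lowerCentral G (i + 1) ≤ H := hi ▸ Nat.find_spec hex
  have hiH' : ¬ lowerCentral G i ≤ H := Nat.find_min hex (by omega)
  obtain ⟨K, hK, hiK⟩ : ∃ K ∈ {K : Subgroup G | K.Normal ∧ IsOpen (K : Set G) ∧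
      eindex K ≤ ((p ^ n : ℕ) : ℕ∞)}, ¬ lowerCentral G i ≤ K := by
    by_contra! hcon
    exact hiH' (le_sInf hcon)
  obtain ⟨z, hz, hzK⟩ := SetLike.not_le_iff_exists.1 hiK
  have hmain := hc.index_lowerCentral_succ_mul_le hG h.1 hexp hK.1 hK.2.1
    (eindex_le_natCast.1 hK.2.2).2 hz hzK
  obtain ⟨d, hd⟩ := hG.exists_index_eq_pow (lowerCentral_normal (i + 1)) (h.1 (i + 1))
  rw [hd, ← pow_succ, Nat.pow_le_pow_iff_right hp.out.one_lt] at hmain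
  refine ⟨d, i + 1, by omega, ?_⟩
  have hcore0 : (obliqueCore (lowerCentral G (i + 1))).index ≠ 0 :=
    index_ne_zero_of_isOpen (IsOpen.lowerCentral_obliqueCore h.1 (hB0 _))
  have hfin : (obliqueCore (lowerCentral G (i + 1))).FiniteIndex := ⟨hcore0⟩
  have hmono := obliqueCore_mono hiH
  have hfin' := Subgroup.finiteIndex_of_le hmono
  rw [obFun, ← hH, eindex_eq_index hfin'.index_ne_zero, hB, ← Nat.cast_pow, ← Nat.cast_mul,
    Nat.cast_le, ← hd, mul_comm, Subgroup.relIndex_mul_index (obliqueCore_le_self _)]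
  exact Subgroup.index_antitone hmono

theorem IsProP.obFun_le_rpow (hG : IsProP p G) (h : HasFiniteObliquity p G)
    (hcard : (p : ℕ∞) < ENat.card G) {c w : ℕ} {o : ℝ} (hc : NormalIntersectionLE p G c)
    (hw : LowerCentralWidthLE p G w) (ho : obliquity p G ≤ (o : EReal)) (n : ℕ) :
    (obFun G (p ^ n) : ℝ≥0∞) ≤
      (p : ℝ≥0∞) ^ ((n : ℝ) + (c : ℝ) + (w : ℝ) + o - 2) := by
  obtain ⟨d, i, hd, hle⟩ := hG.exists_obFun_le h hcard hc hw n
  have hp0 : (p : ℝ≥0∞) ≠ 0 := by exact_mod_cast hp.out.ne_zero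
  have hp1 : (1 : ℝ≥0∞) ≤ p := by exact_mod_cast hp.out.one_lt.le
  have hle' := ENat.toENNReal_le.2 hle
  rw [ENat.toENNReal_mul, ENat.toENNReal_pow, ENat.toENNReal_coe] at hle'
  calc (obFun G (p ^ n) : ℝ≥0∞)
      ≤ (p : ℝ≥0∞) ^ (d : ℝ) * (p : ℝ≥0∞) ^ o := by
        refine hle'.trans ?_
        rw [ENNReal.rpow_natCast]
        gcongr
        exact erelIndex_obliqueCore_le ho i
    _ = (p : ℝ≥0∞) ^ ((d : ℝ) + o) :=
        (ENNReal.rpow_add _ _ hp0 (ENNReal.natCast_ne_top p)).symm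
    _ ≤ _ := by
        refine ENNReal.rpow_le_rpow_of_exponent_le hp1 ?_
        have : (d : ℝ) + 2 ≤ n + c + w := by exact_mod_cast hd
        linarith

end Bound

/-! ### Finite obliquity implies linear growth -/

section LinearGrowth

variable {p : ℕ} [hp : Fact p.Prime] {G : Type*} [Group G] [TopologicalSpace G]
  [IsTopologicalGroup G] [CompactSpace G] [T2Space G] [TotallyDisconnectedSpace G]

theorem OpenNormalChain.obLinearBound {G : Type*} [Group G] [TopologicalSpace G]
    [IsTopologicalGroup G] [CompactSpace G] (h : OpenNormalChain G) : ObLinearBound G 1 := by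
  intro n hn
  have := ENat.toENNReal_le.2 (h.obFun_le hn)
  simpa using this

/-- Indices in a pro-`p` group are powers of `p`, so `I_n` only depends on the largest power of
`p` that is at most `n`. -/
theorem IsProP.normalIndexCore_eq (hG : IsProP p G) {n : ℕ} (hn : n ≠ 0) :
    normalIndexCore G n = normalIndexCore G (p ^ Nat.log p n) := by
  have : {K : Subgroup G | K.Normal ∧ IsOpen (K : Set G) ∧ eindex K ≤ (n : ℕ∞)} =
      {K : Subgroup G | K.Normal ∧ IsOpen (K : Set G) ∧
        eindex K ≤ ((p ^ Nat.log p n : ℕ) : ℕ∞)} := by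
    ext K
    refine and_congr_right fun hK => and_congr_right fun hKo => ?_
    obtain ⟨k, hk⟩ := hG.exists_index_eq_pow hK hKo
    rw [eindex_eq_index (index_ne_zero_of_isOpen hKo), hk, Nat.cast_le, Nat.cast_le,
      Nat.pow_le_pow_iff_right hp.out.one_lt, Nat.le_log_iff_pow_le hp.out.one_lt hn]
  rw [normalIndexCore, this, ← normalIndexCore]

theorem obLinearBound_of_finite {G : Type*} [Group G] [TopologicalSpace G] [Finite G] :
    ObLinearBound G (Nat.card G) := by
  intro n hn
  have h : obFun G n ≤ ((Nat.card G * n : ℕ) : ℕ∞) := by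
    refine eindex_le_natCast.2 ⟨Subgroup.FiniteIndex.index_ne_zero, ?_⟩
    exact (Nat.le_of_dvd Nat.card_pos (Subgroup.index_dvd_card _)).trans
      (Nat.le_mul_of_pos_right _ hn)
  have := ENat.toENNReal_le.2 h
  simpa using this

theorem IsProP.exists_obLinearBound (hG : IsProP p G) (h : HasFiniteObliquity p G) :
    ∃ k : ℝ≥0, ObLinearBound G k := by
  rcases le_or_gt (ENat.card G) (p : ℕ∞) with hcard | hcard
  · have : Finite G := by
      rw [← ENat.card_lt_top]
      exact hcard.trans_lt (ENat.natCast_lt_top p)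
    exact ⟨_, obLinearBound_of_finite⟩
  obtain ⟨w, hw⟩ := h.exists_lowerCentralWidthLE
  obtain ⟨c, hc⟩ := h.exists_normalIntersectionLE hG
  obtain ⟨o, ho, -⟩ := EReal.lt_iff_exists_real_btwn.1 h.2
  have hp0 : (p : ℝ≥0∞) ≠ 0 := by exact_mod_cast hp.out.ne_zero
  have hne : (p : ℝ≥0∞) ^ ((c : ℝ) + w + o - 2) ≠ ⊤ :=
    ENNReal.rpow_ne_top_of_ne_zero hp0 (ENNReal.natCast_ne_top p)
  refine ⟨((p : ℝ≥0∞) ^ ((c : ℝ) + w + o - 2)).toNNReal, fun n hn => ?_⟩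
  have hn0 : n ≠ 0 := by omega
  have hob : obFun G n = obFun G (p ^ Nat.log p n) := by
    rw [obFun, obFun, hG.normalIndexCore_eq hn0]
  rw [hob, ENNReal.coe_toNNReal hne]
  refine (hG.obFun_le_rpow h hcard hc hw ho.le _).trans ?_
  rw [show ((Nat.log p n : ℕ) : ℝ) + c + w + o - 2 = (c + w + o - 2) + (Nat.log p n : ℕ) by ring,
    ENNReal.rpow_add _ _ hp0 (ENNReal.natCast_ne_top p), ENNReal.rpow_natCast]
  gcongr
  exact_mod_cast Nat.pow_log_le_self p hn0

end LinearGrowth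

/-! ### Procyclic pro-`p` groups -/

section Procyclic

/-- A continuous bijective homomorphism from a compact group to a Hausdorff group is an
isomorphism of topological groups. -/
noncomputable def ContinuousMulEquiv.ofCompactToT2 {A B : Type*} [Group A] [TopologicalSpace A]
    [CompactSpace A] [Group B] [TopologicalSpace B] [T2Space B] (f : A →* B) (hf : Continuous f)
    (hb : Function.Bijective f) : A ≃ₜ* B :=
  { MulEquiv.ofBijective f hb with
    continuous_toFun := hf
    continuous_invFun := (Continuous.homeoOfEquivCompactToT2
      (f := (MulEquiv.ofBijective f hb).toEquiv) hf).continuous_symm }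

variable {p : ℕ} [hp : Fact p.Prime] {G : Type*} [Group G] [TopologicalSpace G]
  [IsTopologicalGroup G] [CompactSpace G] [T2Space G] [TotallyDisconnectedSpace G]

omit hp [T2Space G] in
theorem exists_open_normal_index_gt [Infinite G] (B : ℕ) :
    ∃ U : Subgroup G, U.Normal ∧ IsOpen (U : Set G) ∧ B < U.index := by
  induction B with
  | zero => exact ⟨⊤, inferInstance, isOpen_univ, by simp⟩
  | succ B ih =>
    obtain ⟨U, hUn, hUo, hU⟩ := ih
    have hU1 : U ≠ ⊥ := by
      rintro rfl
      have := index_ne_zero_of_isOpen hUo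
      rw [Subgroup.index_bot] at this
      exact this Nat.card_eq_zero_of_infinite
    obtain ⟨u, huU, hu1⟩ := U.bot_or_exists_ne_one.resolve_left hU1
    obtain ⟨V, hVn, hVo, huV⟩ := exists_open_normal_notMem hu1
    have hUV : IsOpen ((U ⊓ V : Subgroup G) : Set G) := by
      rw [Subgroup.coe_inf]
      exact hUo.inter hVo
    have hlt : U ⊓ V < U := lt_of_le_of_ne inf_le_left fun h => huV (inf_eq_left.1 h huU)
    have := index_lt_of_lt_of_index_ne_zero hlt (index_ne_zero_of_isOpen hUV)
    exact ⟨U ⊓ V, inferInstance, hUV, by omega⟩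

omit hp [CompactSpace G] [T2Space G] [TotallyDisconnectedSpace G] in
theorem orderOf_mk_eq_index {x : G} (hx : (Subgroup.zpowers x).topologicalClosure = ⊤)
    {U : Subgroup G} [U.Normal] (hU : IsOpen (U : Set G)) : orderOf (x : G ⧸ U) = U.index := by
  have htop : Subgroup.zpowers x ⊔ U = ⊤ := by
    rw [← top_le_iff, ← hx]
    exact Subgroup.topologicalClosure_minimal _ le_sup_left
      (Subgroup.isClosed_of_isOpen _ (Subgroup.isOpen_mono le_sup_right hU))
  have h := Subgroup.relIndex_ker (Subgroup.zpowers x) (QuotientGroup.mk' U)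
  rw [QuotientGroup.ker_mk', MonoidHom.map_zpowers, Nat.card_zpowers] at h
  rw [← Subgroup.relIndex_top_right, ← htop, sup_comm, Subgroup.relIndex_sup_left, h]
  rfl

omit hp [CompactSpace G] [T2Space G] [TotallyDisconnectedSpace G] in
theorem zpow_mem_iff_index_dvd {x : G} (hx : (Subgroup.zpowers x).topologicalClosure = ⊤)
    {U : Subgroup G} [U.Normal] (hU : IsOpen (U : Set G)) (n : ℤ) :
    x ^ n ∈ U ↔ (U.index : ℤ) ∣ n := by
  rw [← orderOf_mk_eq_index hx hU, orderOf_dvd_iff_zpow_eq_one]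
  exact (QuotientGroup.eq_one_iff (x ^ n)).symm

theorem ofAdd_intCast_mem_padicPowSubgroup {k : ℕ} {n : ℤ} :
    Multiplicative.ofAdd (n : ℤ_[p]) ∈ padicPowSubgroup p k ↔ (p ^ k : ℤ) ∣ n :=
  mem_padicPowSubgroup.trans PadicInt.norm_int_le_pow_iff_dvd

theorem eq_one_of_mem_padicPowSubgroup {a : Multiplicative ℤ_[p]}
    (h : ∀ k, a ∈ padicPowSubgroup p k) : a = 1 := by
  by_contra ha
  obtain ⟨k, hk⟩ := PadicInt.exists_pow_neg_lt p (norm_pos_iff.2 (show a.toAdd ≠ 0 from ha))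
  exact absurd (mem_padicPowSubgroup.1 (h k)) (not_le.2 hk)

variable (p) in
/-- The closed subgroup of `G × ℤ_p` generated by `(x, 1)`. When `x` generates an infinite pro-`p`
group topologically, it is the graph of the isomorphism `G ≅ ℤ_p` that takes `x` to `1`. -/
noncomputable def padicGraph (x : G) : Subgroup (G × Multiplicative ℤ_[p]) :=
  (Subgroup.zpowers (x, Multiplicative.ofAdd (1 : ℤ_[p]))).topologicalClosure

omit [CompactSpace G] [T2Space G] [TotallyDisconnectedSpace G] in
theorem exists_zpow_mem_of_mem_padicGraph {x : G} {y : G × Multiplicative ℤ_[p]}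
    (hy : y ∈ padicGraph p x) {U : Subgroup G} (hU : IsOpen (U : Set G)) (k : ℕ) :
    ∃ n : ℤ, y.1⁻¹ * x ^ n ∈ U ∧
      y.2⁻¹ * Multiplicative.ofAdd (n : ℤ_[p]) ∈ padicPowSubgroup p k := by
  have hopen : IsOpen {z : G × Multiplicative ℤ_[p] |
      y.1⁻¹ * z.1 ∈ U ∧ y.2⁻¹ * z.2 ∈ padicPowSubgroup p k} :=
    (hU.preimage ((continuous_const_mul y.1⁻¹).comp continuous_fst)).inter
      ((isOpen_padicPowSubgroup k).preimage ((continuous_const_mul y.2⁻¹).comp continuous_snd))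
  obtain ⟨z, hz, hz'⟩ := mem_closure_iff.1 hy _ hopen (by simp [one_mem])
  obtain ⟨n, rfl⟩ := Subgroup.mem_zpowers_iff.1 hz'
  refine ⟨n, hz.1, ?_⟩
  have h := hz.2
  rw [Prod.pow_mk, ← ofAdd_zsmul, zsmul_one] at h
  exact h

theorem eq_one_of_mk_one_mem_padicGraph (hG : IsProP p G) [Infinite G] {x : G}
    (hx : (Subgroup.zpowers x).topologicalClosure = ⊤) {a : Multiplicative ℤ_[p]}
    (ha : ((1 : G), a) ∈ padicGraph p x) : a = 1 := by
  refine eq_one_of_mem_padicPowSubgroup fun k => ?_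
  obtain ⟨U, hUn, hUo, hU⟩ := exists_open_normal_index_gt (G := G) (p ^ k)
  obtain ⟨e, he⟩ := hG.exists_index_eq_pow hUn hUo
  obtain ⟨n, hn, hna⟩ := exists_zpow_mem_of_mem_padicGraph ha hUo k
  simp only [inv_one, one_mul] at hn
  have hdvd := (zpow_mem_iff_index_dvd hx hUo n).1 hn
  rw [he] at hdvd hU
  have hke : k ≤ e := ((Nat.pow_lt_pow_iff_right hp.out.one_lt).1 hU).le
  have hn' : Multiplicative.ofAdd (n : ℤ_[p]) ∈ padicPowSubgroup p k :=
    ofAdd_intCast_mem_padicPowSubgroup.2 ((pow_dvd_pow (p : ℤ) hke).trans (by exact_mod_cast hdvd))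
  have := (Subgroup.mul_mem_cancel_right _ hn').1 hna
  exact inv_mem_iff.1 this

theorem eq_one_of_mk_mem_padicGraph (hG : IsProP p G) {x : G}
    (hx : (Subgroup.zpowers x).topologicalClosure = ⊤) {g : G}
    (hg : (g, (1 : Multiplicative ℤ_[p])) ∈ padicGraph p x) : g = 1 := by
  by_contra hg1
  obtain ⟨U, hUn, hUo, hgU⟩ := exists_open_normal_notMem hg1
  obtain ⟨e, he⟩ := hG.exists_index_eq_pow hUn hUo
  obtain ⟨n, hn, hna⟩ := exists_zpow_mem_of_mem_padicGraph hg hUo e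
  simp only [inv_one, one_mul] at hna
  have hxU : x ^ n ∈ U := (zpow_mem_iff_index_dvd hx hUo n).2 (by
    rw [he]
    exact_mod_cast ofAdd_intCast_mem_padicPowSubgroup.1 hna)
  exact hgU (inv_mem_iff.1 ((Subgroup.mul_mem_cancel_right _ hxU).1 hn))

/-- A homomorphism defined on a compact group is surjective if its image contains a dense set. -/
theorem MonoidHom.surjective_of_topologicalClosure_le_range {A B : Type*} [Group A]
    [TopologicalSpace A] [CompactSpace A] [Group B] [TopologicalSpace B] [IsTopologicalGroup B]
    [T2Space B] (f : A →* B) (hf : Continuous f) {D : Subgroup B} (hD : D.topologicalClosure = ⊤)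
    (hDf : D ≤ f.range) : Function.Surjective f := by
  rw [← MonoidHom.range_eq_top, ← top_le_iff, ← hD]
  refine Subgroup.topologicalClosure_minimal _ hDf ?_
  rw [MonoidHom.coe_range]
  exact (isCompact_range hf).isClosed

theorem topologicalClosure_zpowers_ofAdd_one :
    (Subgroup.zpowers (Multiplicative.ofAdd (1 : ℤ_[p]))).topologicalClosure = ⊤ := by
  rw [eq_top_iff]
  intro a _
  have := ofAdd_mul_mem_of_isClosed (Subgroup.isClosed_topologicalClosure _)
    (Subgroup.le_topologicalClosure _
      (Subgroup.mem_zpowers (Multiplicative.ofAdd (1 : ℤ_[p])))) a.toAdd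
  rwa [mul_one] at this

/-- Both projections of the closed subgroup generated by `(x, 1)` are isomorphisms. -/
theorem IsProP.nonempty_continuousMulEquiv_padicInt (hG : IsProP p G) [Infinite G] {x : G}
    (hx : (Subgroup.zpowers x).topologicalClosure = ⊤) :
    Nonempty (G ≃ₜ* Multiplicative ℤ_[p]) := by
  have hclosed : IsClosed (padicGraph p x : Set (G × Multiplicative ℤ_[p])) :=
    Subgroup.isClosed_topologicalClosure _
  have : CompactSpace (padicGraph p x) := isCompact_iff_compactSpace.1 hclosed.isCompact
  let f : padicGraph p x →* G := (MonoidHom.fst _ _).comp (padicGraph p x).subtype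
  let g : padicGraph p x →* Multiplicative ℤ_[p] :=
    (MonoidHom.snd _ _).comp (padicGraph p x).subtype
  have hf : Continuous f := continuous_fst.comp continuous_subtype_val
  have hg : Continuous g := continuous_snd.comp continuous_subtype_val
  let γ : padicGraph p x := ⟨(x, Multiplicative.ofAdd 1),
    Subgroup.le_topologicalClosure _ (Subgroup.mem_zpowers _)⟩
  have hfs : Function.Surjective f :=
    f.surjective_of_topologicalClosure_le_range hf hx
      ((Subgroup.zpowers_le).2 ⟨γ, rfl⟩)
  have hgs : Function.Surjective g :=
    g.surjective_of_topologicalClosure_le_range hg topologicalClosure_zpowers_ofAdd_one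
      ((Subgroup.zpowers_le).2 ⟨γ, rfl⟩)
  have hfi : Function.Injective f := by
    refine (injective_iff_map_eq_one f).2 ?_
    rintro ⟨⟨y, a⟩, hy⟩ (rfl : y = 1)
    exact Subtype.ext (Prod.ext rfl (eq_one_of_mk_one_mem_padicGraph hG hx hy))
  have hgi : Function.Injective g := by
    refine (injective_iff_map_eq_one g).2 ?_
    rintro ⟨⟨y, a⟩, hy⟩ (rfl : a = 1)
    exact Subtype.ext (Prod.ext (eq_one_of_mk_mem_padicGraph hG hx hy) rfl)
  exact ⟨(ContinuousMulEquiv.ofCompactToT2 f hf ⟨hfi, hfs⟩).symm.trans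
    (ContinuousMulEquiv.ofCompactToT2 g hg ⟨hgi, hgs⟩)⟩

end Procyclic

/-! ### Groups all of whose nontrivial closed normal subgroups are open -/

section JustInfinite

/-- Every nontrivial closed normal subgroup is open. An infinite profinite group with this property
is just infinite. -/
def ClosedNormalOpen (G : Type*) [Group G] [TopologicalSpace G] : Prop :=
  ∀ M : Subgroup G, M.Normal → IsClosed (M : Set G) → M ≠ ⊥ → IsOpen (M : Set G)

variable {p : ℕ} [hp : Fact p.Prime] {G : Type*} [Group G] [TopologicalSpace G]
  [IsTopologicalGroup G] [CompactSpace G] [T2Space G]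

omit hp in
/-- A central element of finite order generates a finite normal subgroup. -/
theorem ClosedNormalOpen.eq_one_of_pow_eq_one (h : ClosedNormalOpen G) [Infinite G] {y : G}
    (hy : ∀ g, y * g = g * y) {m : ℕ} (hm : m ≠ 0) (hym : y ^ m = 1) : y = 1 := by
  by_contra hy1
  have hfin : Finite (Subgroup.zpowers y) :=
    (isOfFinOrder_iff_pow_eq_one.2 ⟨m, Nat.pos_of_ne_zero hm, hym⟩).finite_zpowers
  have hn : (Subgroup.zpowers y).Normal := by
    refine ⟨fun z hz g => ?_⟩
    obtain ⟨k, rfl⟩ := Subgroup.mem_zpowers_iff.1 hz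
    have hc : Commute y g := hy g
    rw [← (hc.zpow_left k).eq, mul_inv_cancel_right]
    exact hz
  have hclosed : IsClosed (Subgroup.zpowers y : Set G) := (Set.toFinite _).isClosed
  have hopen := h _ hn hclosed (Subgroup.zpowers_ne_bot.2 hy1)
  have hG : Finite G := (Subgroup.finite_iff_finite_and_finiteIndex (H := Subgroup.zpowers y)).2
    ⟨hfin, ⟨index_ne_zero_of_isOpen hopen⟩⟩
  exact not_finite G

omit hp in
/-- If some `γ_i` is not open, then the last nontrivial term of the lower central series is an open
central subgroup. Unless `G` is commutative, its exponent divides that of `G / γ_2`, so it is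
torsion, which is impossible. -/
theorem ClosedNormalOpen.mul_comm_of_not_lowerCentralOpen (h : ClosedNormalOpen G)
    [Infinite G] (hno : ¬ LowerCentralOpen G) (a b : G) : a * b = b * a := by
  classical
  have hex : ∃ i, lowerCentral G i = ⊥ := by
    by_contra! hcon
    exact hno fun i => h _ (lowerCentral_normal i) (isClosed_lowerCentral i) (hcon i)
  obtain ⟨i, hi⟩ : ∃ i, Nat.find hex = i + 1 :=
    Nat.exists_eq_succ_of_ne_zero fun h0 => by
      have := Nat.find_spec hex
      rw [h0] at this
      exact top_ne_bot this
  have hbot : lowerCentral G (i + 1) = ⊥ := hi ▸ Nat.find_spec hex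
  have hne : lowerCentral G i ≠ ⊥ := Nat.find_min hex (by omega)
  have hcomm : ∀ y ∈ lowerCentral G i, ∀ g, y * g = g * y := fun y hy g => by
    have := commutatorElement_mem_lowerCentral hy g
    rw [hbot, Subgroup.mem_bot] at this
    exact commutatorElement_eq_one_iff_mul_comm.1 this
  cases i with
  | zero => exact hcomm a trivial b
  | succ i =>
    exfalso
    have hopen : IsOpen (lowerCentral G 1 : Set G) :=
      Subgroup.isOpen_mono (lowerCentral_antitone (Nat.le_add_left 1 i))
        (h _ (lowerCentral_normal _) (isClosed_lowerCentral _) hne)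
    obtain ⟨y, hy, hy1⟩ := (lowerCentral G (i + 1)).bot_or_exists_ne_one.resolve_left hne
    refine hy1 (h.eq_one_of_pow_eq_one (hcomm y hy) (index_ne_zero_of_isOpen hopen) ?_)
    have := pow_mem_lowerCentral_succ (fun g => Subgroup.pow_index_mem (lowerCentral G 1) g) hy
    rwa [hbot, Subgroup.mem_bot] at this

omit hp in
/-- A procyclic group is the union of finitely many cosets of its subgroup of `m`-th powers. -/
theorem exists_pow_mul_pow_of_mem_topologicalClosure_zpowers {m : ℕ} (hm : 0 < m)
    {y c : G} (hc : c ∈ (Subgroup.zpowers y).topologicalClosure) :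
    ∃ j < m, ∃ d ∈ (Subgroup.zpowers y).topologicalClosure, c = y ^ j * d ^ m := by
  set C := (Subgroup.zpowers y).topologicalClosure with hC
  have hCc : IsClosed (C : Set G) := Subgroup.isClosed_topologicalClosure _
  have hclosed : IsClosed (⋃ j ∈ Finset.range m, (fun d => y ^ j * d ^ m) '' (C : Set G)) :=
    isClosed_biUnion_finset fun j _ =>
      (hCc.isCompact.image (continuous_const.mul (continuous_pow m))).isClosed
  have hsub : (C : Set G) ⊆ ⋃ j ∈ Finset.range m, (fun d => y ^ j * d ^ m) '' (C : Set G) := by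
    refine closure_minimal ?_ hclosed
    intro z hz
    obtain ⟨n, rfl⟩ := Subgroup.mem_zpowers_iff.1 hz
    have hm' : (0 : ℤ) < m := by exact_mod_cast hm
    obtain ⟨j, hj⟩ := Int.eq_ofNat_of_zero_le (Int.emod_nonneg n hm'.ne')
    have hjm : j < m := by
      have := Int.emod_lt_of_pos n hm'
      omega
    refine Set.mem_biUnion (Finset.mem_coe.2 (Finset.mem_range.2 hjm))
      ⟨y ^ (n / m), Subgroup.le_topologicalClosure _ (zpow_mem (Subgroup.mem_zpowers y) _), ?_⟩
    change y ^ j * (y ^ (n / m)) ^ m = y ^ n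
    rw [← zpow_natCast y j, ← zpow_natCast (y ^ (n / m)) m, ← zpow_mul, ← zpow_add]
    congr 1
    have := Int.emod_add_mul_ediv n m
    rw [hj] at this
    linarith
  obtain ⟨j, hj, d, hd, hdc⟩ := Set.mem_iUnion₂.1 (hsub hc)
  exact ⟨j, Finset.mem_range.1 hj, d, hd, hdc.symm⟩

variable [TotallyDisconnectedSpace G]

/-- Choose `y ≠ 1` such that the closed subgroup `C` that it generates has minimal index. If
`C ≠ G`, then some `z` outside `C` has its `p`-th power in `C`; as `G` is torsion-free, `z ^ p` is
not a `p`-th power in `C`, and so `y` is a `p`-th power of an element outside `C`. -/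
theorem ClosedNormalOpen.exists_topologicalClosure_zpowers_eq_top (h : ClosedNormalOpen G)
    (hG : IsProP p G) [Infinite G] (hcomm : ∀ a b : G, a * b = b * a) :
    ∃ x : G, (Subgroup.zpowers x).topologicalClosure = ⊤ := by
  classical
  let C : G → Subgroup G := fun y => (Subgroup.zpowers y).topologicalClosure
  have hmem : ∀ y, y ∈ C y := fun y =>
    Subgroup.le_topologicalClosure _ (Subgroup.mem_zpowers y)
  have hnormal : ∀ H : Subgroup G, H.Normal := fun H =>
    ⟨fun n hn g => by rwa [hcomm g n, mul_inv_cancel_right]⟩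
  have hopen : ∀ y, y ≠ 1 → IsOpen (C y : Set G) := fun y hy =>
    h _ (hnormal _) (Subgroup.isClosed_topologicalClosure _) fun hb =>
      hy (Subgroup.mem_bot.1 (hb ▸ hmem y))
  obtain ⟨y₀, hy₀⟩ := exists_ne (1 : G)
  have hex : ∃ n, ∃ y : G, y ≠ 1 ∧ (C y).index = n := ⟨_, y₀, hy₀, rfl⟩
  obtain ⟨y, hy1, hyn⟩ := Nat.find_spec hex
  have hmin : ∀ u, u ≠ 1 → (C y).index ≤ (C u).index := fun u hu =>
    hyn.trans_le (Nat.find_min' hex ⟨u, hu, rfl⟩)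
  refine ⟨y, ?_⟩
  by_contra hne
  have := hnormal (C y)
  have hfin : Finite (G ⧸ C y) := Subgroup.quotient_finite_of_isOpen _ (hopen y hy1)
  have hdvd : p ∣ Nat.card (G ⧸ C y) :=
    (hG.isPGroup_quotient (hopen y hy1)).card_eq_or_dvd.resolve_left fun h1 =>
      hne (Subgroup.index_eq_one.1 h1)
  obtain ⟨q, hq⟩ := exists_prime_orderOf_dvd_card' p hdvd
  obtain ⟨z, rfl⟩ := QuotientGroup.mk_surjective q
  have hzC : z ∉ C y := fun hz => by
    rw [(QuotientGroup.eq_one_iff z).2 hz, orderOf_one] at hq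
    exact hp.out.one_lt.ne hq
  have hzp : z ^ p ∈ C y := by
    refine (QuotientGroup.eq_one_iff (z ^ p)).1 ?_
    have := pow_orderOf_eq_one (z : G ⧸ C y)
    rwa [hq] at this
  obtain ⟨j, hjp, d, hd, hzd⟩ :=
    exists_pow_mul_pow_of_mem_topologicalClosure_zpowers hp.out.pos hzp
  -- replace `z` by an element with `z ^ p = y ^ j`
  obtain ⟨v, hvC, hv⟩ : ∃ v, v ∉ C y ∧ v ^ p = y ^ j := by
    refine ⟨z * d⁻¹, fun hv => hzC ((Subgroup.mul_mem_cancel_right _ (inv_mem hd)).1 hv), ?_⟩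
    rw [(show Commute z d⁻¹ from hcomm _ _).mul_pow, hzd, inv_pow, mul_inv_cancel_right]
  have hj0 : j ≠ 0 := by
    rintro rfl
    rw [pow_zero] at hv
    exact hvC (h.eq_one_of_pow_eq_one (hcomm v) hp.out.ne_zero hv ▸ one_mem _)
  have hcop : IsCoprime (j : ℤ) (p : ℤ) :=
    Nat.isCoprime_iff_coprime.2 ((hp.out.coprime_iff_not_dvd).2
      (Nat.not_dvd_of_pos_of_lt (Nat.pos_of_ne_zero hj0) hjp)).symm
  obtain ⟨a, b, hab⟩ := hcop
  have hv' : v ^ (p : ℤ) = y ^ (j : ℤ) := by rw [zpow_natCast, zpow_natCast, hv]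
  have hu : (v ^ a * y ^ b) ^ (p : ℤ) = y := by
    rw [(show Commute (v ^ a) (y ^ b) from hcomm _ _).mul_zpow, ← zpow_mul, mul_comm a, zpow_mul,
      hv', ← zpow_mul, ← zpow_mul, ← zpow_add, mul_comm (j : ℤ), hab, zpow_one]
  have huC : v ^ a * y ^ b ∉ C y := fun huC => by
    have hva := (Subgroup.mul_mem_cancel_right _ (zpow_mem (hmem y) b)).1 huC
    refine hvC ?_
    rw [← zpow_one v, ← hab, zpow_add, zpow_mul, mul_comm b, zpow_mul, hv']
    exact mul_mem (zpow_mem hva _) (zpow_mem (zpow_mem (hmem y) _) _)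
  have hu1 : v ^ a * y ^ b ≠ 1 := fun h1 => huC (h1 ▸ one_mem _)
  have hle : C y ≤ C (v ^ a * y ^ b) := by
    refine Subgroup.topologicalClosure_minimal _ ((Subgroup.zpowers_le).2 ?_)
      (Subgroup.isClosed_topologicalClosure _)
    have := zpow_mem (hmem (v ^ a * y ^ b)) (p : ℤ)
    rwa [hu] at this
  have hlt := index_lt_of_lt_of_index_ne_zero
    (lt_of_le_of_ne hle fun heq => huC (heq ▸ hmem _)) (index_ne_zero_of_isOpen (hopen y hy1))
  exact absurd (hmin _ hu1) (not_le.2 hlt)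

end JustInfinite

/-! ### Linear growth implies finite obliquity or procyclicity -/

section LinearGrowthConverse

variable {p : ℕ} [hp : Fact p.Prime] {G : Type*} [Group G] [TopologicalSpace G]
  [IsTopologicalGroup G] [CompactSpace G] [T2Space G] [TotallyDisconnectedSpace G]

theorem ObLinearBound.index_ne_zero {G : Type*} [Group G] [TopologicalSpace G] {k : ℝ≥0}
    (h : ObLinearBound G k) {n : ℕ} (hn : 1 ≤ n) :
    (obliqueCore (normalIndexCore G n)).index ≠ 0 := by
  intro h0
  have h1 := h n hn
  rw [obFun, eindex_eq_top h0, ENat.toENNReal_top, top_le_iff] at h1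
  exact ENNReal.mul_ne_top ENNReal.coe_ne_top (ENNReal.natCast_ne_top n) h1

/-- A nontrivial closed normal subgroup is not contained in `I_n` for some `n`, and then it contains
the oblique core of `I_n`, which has finite index. -/
theorem ObLinearBound.closedNormalOpen {G : Type*} [Group G] [TopologicalSpace G]
    [IsTopologicalGroup G] [CompactSpace G] [TotallyDisconnectedSpace G] {k : ℝ≥0}
    (h : ObLinearBound G k) :
    ClosedNormalOpen G := by
  intro M hM hMc hM1
  obtain ⟨x, hxM, hx1⟩ := M.bot_or_exists_ne_one.resolve_left hM1
  obtain ⟨U, hUn, hUo, hxU⟩ := exists_open_normal_notMem hx1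
  have hU0 := index_ne_zero_of_isOpen hUo
  have hIU : normalIndexCore G U.index ≤ U :=
    normalIndexCore_le hUn hUo (eindex_eq_index hU0).le
  have hle := obliqueCore_le_of_not_le hM hMc fun hMI => hxU (hIU (hMI hxM))
  have : (obliqueCore (normalIndexCore G U.index)).FiniteIndex :=
    ⟨h.index_ne_zero (Nat.one_le_iff_ne_zero.2 hU0)⟩
  exact isOpen_of_isClosed_of_index_ne_zero hMc (Subgroup.finiteIndex_of_le hle).index_ne_zero

theorem ObLinearBound.one_le {G : Type*} [Group G] [TopologicalSpace G] {k : ℝ≥0}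
    (h : ObLinearBound G k) : 1 ≤ k := by
  have h1 := h 1 le_rfl
  have h2 : (1 : ℕ∞) ≤ obFun G 1 := by
    rw [obFun, eindex_eq_index (h.index_ne_zero le_rfl)]
    exact_mod_cast Nat.one_le_iff_ne_zero.2 (h.index_ne_zero le_rfl)
  have h3 := (ENat.toENNReal_le.2 h2).trans h1
  simpa using h3

omit [T2Space G] [TotallyDisconnectedSpace G] in
/-- With `n = |G : γ_i|`, the group `I_n` is contained in `γ_i`, and so is its oblique core in that
of `γ_i`. -/
theorem ObLinearBound.obliquity_le {k : ℝ≥0} (h : ObLinearBound G k) (ho : LowerCentralOpen G) :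
    obliquity p G ≤ ((Real.logb (p : ℝ) (k : ℝ) : ℝ) : EReal) := by
  refine iSup_le fun i => ithObliquity_le_coe_iff.2 ?_
  have hk : (p : ℝ≥0∞) ^ Real.logb (p : ℝ) (k : ℝ) = (k : ℝ≥0∞) := by
    have hp0 : (0 : ℝ) < p := by exact_mod_cast hp.out.pos
    have hp1 : (p : ℝ) ≠ 1 := by exact_mod_cast hp.out.one_lt.ne'
    have hk0 : (0 : ℝ) < k := by exact_mod_cast zero_lt_one.trans_le h.one_le
    rw [← ENNReal.ofReal_natCast, ENNReal.ofReal_rpow_of_pos hp0,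
      Real.rpow_logb hp0 hp1 hk0, ENNReal.ofReal_coe_nnreal]
  rw [hk]
  set n := (lowerCentral G i).index with hn
  have hn0 : n ≠ 0 := index_ne_zero_of_isOpen (ho i)
  have hn1 : 1 ≤ n := Nat.one_le_iff_ne_zero.2 hn0
  have hmono := obliqueCore_mono (normalIndexCore_le (lowerCentral_normal i) (ho i)
    (eindex_eq_index hn0).le)
  have hfin : (obliqueCore (normalIndexCore G n)).FiniteIndex := ⟨h.index_ne_zero hn1⟩
  have hfin' := (Subgroup.finiteIndex_of_le hmono).index_ne_zero
  have hmul := Subgroup.relIndex_mul_index (obliqueCore_le_self (lowerCentral G i))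
  have hrel0 : (obliqueCore (lowerCentral G i)).relIndex (lowerCentral G i) ≠ 0 := fun h0 => by
    rw [h0, zero_mul] at hmul
    exact hfin' hmul.symm
  have hle : (((obliqueCore (lowerCentral G i)).relIndex (lowerCentral G i) * n : ℕ) : ℕ∞) ≤
      obFun G n := by
    rw [obFun, eindex_eq_index (h.index_ne_zero hn1), hmul, Nat.cast_le]
    exact Subgroup.index_antitone hmono
  have hle' := (ENat.toENNReal_le.2 hle).trans (h n hn1)
  rw [ENat.toENNReal_coe, Nat.cast_mul, ENNReal.mul_le_mul_iff_left (by exact_mod_cast hn0)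
    (ENNReal.natCast_ne_top n)] at hle'
  rw [erelIndex, eindex_eq_index hrel0, ENat.toENNReal_coe]
  exact hle'

theorem ObLinearBound.nonempty_continuousMulEquiv_or (hG : IsProP p G) {k : ℝ≥0}
    (h : ObLinearBound G k) :
    Nonempty (G ≃ₜ* Multiplicative ℤ_[p]) ∨
      (LowerCentralOpen G ∧ obliquity p G ≤ ((Real.logb (p : ℝ) (k : ℝ) : ℝ) : EReal)) := by
  by_cases ho : LowerCentralOpen G
  · exact Or.inr ⟨ho, h.obliquity_le ho⟩
  left
  have hinf : Infinite G := by
    by_contra hfin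
    have := not_infinite_iff_finite.1 hfin
    exact ho fun i => isOpen_of_isClosed_of_index_ne_zero (isClosed_lowerCentral i)
      Subgroup.FiniteIndex.index_ne_zero
  have hcno := h.closedNormalOpen
  obtain ⟨x, hx⟩ := hcno.exists_topologicalClosure_zpowers_eq_top hG
    (hcno.mul_comm_of_not_lowerCentralOpen ho)
  exact hG.nonempty_continuousMulEquiv_padicInt hx

end LinearGrowthConverse

theorem mainTheorem10 (p : ℕ) [Fact p.Prime] :
    -- the function of the `p`-adic integers: the largest power of `p` that is at most `n`
    (∀ n : ℕ, 1 ≤ n →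
      IsGreatest {m : ℕ∞ | ∃ k : ℕ, m = (p : ℕ∞) ^ k ∧ m ≤ (n : ℕ∞)}
        (obFun (Multiplicative ℤ_[p]) n)) ∧
    ∀ (G : Type*) [Group G] [TopologicalSpace G] [IsTopologicalGroup G] [CompactSpace G]
      [T2Space G] [TotallyDisconnectedSpace G], IsProP p G →
      -- linear growth characterises `ℤ_p` and the groups of finite obliquity
      ((∃ k : ℝ≥0, ObLinearBound G k) ↔
        (Nonempty (G ≃ₜ* Multiplicative ℤ_[p]) ∨ HasFiniteObliquity p G)) ∧
      -- the invariants `w` and `c` of a group of finite obliquity exist ...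
      (HasFiniteObliquity p G →
        (∃ w : ℕ, LowerCentralWidthLE p G w) ∧ (∃ c : ℕ, NormalIntersectionLE p G c)) ∧
      -- ... and give the explicit bound
      (HasFiniteObliquity p G → (p : ℕ∞) < ENat.card G →
        ∀ (c w : ℕ) (o : ℝ), NormalIntersectionLE p G c → LowerCentralWidthLE p G w →
          obliquity p G = (o : EReal) →
          ∀ n : ℕ, (obFun G (p ^ n) : ℝ≥0∞) ≤
            (p : ℝ≥0∞) ^ ((n : ℝ) + (c : ℝ) + (w : ℝ) + o - 2)) ∧
      -- the constant `k` bounds the obliquity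
      (∀ k : ℝ≥0, ObLinearBound G k →
        Nonempty (G ≃ₜ* Multiplicative ℤ_[p]) ∨
          (LowerCentralOpen G ∧ obliquity p G ≤ ((Real.logb (p : ℝ) (k : ℝ) : ℝ) : EReal))) := by
  refine ⟨fun n hn => isGreatest_obFun_padicInt hn, ?_⟩
  intro G _ _ _ _ _ _ hG
  refine ⟨⟨?_, ?_⟩, fun h => ⟨h.exists_lowerCentralWidthLE, h.exists_normalIntersectionLE hG⟩,
    fun h hcard c w o hc hw ho n => hG.obFun_le_rpow h hcard hc hw ho.le n,
    fun k hk => hk.nonempty_continuousMulEquiv_or hG⟩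
  · rintro ⟨k, hk⟩
    exact (hk.nonempty_continuousMulEquiv_or hG).imp_right fun h =>
      ⟨h.1, h.2.trans_lt (EReal.coe_lt_top _)⟩
  · rintro (⟨⟨e⟩⟩ | h)
    · exact ⟨1, (openNormalChain_padicInt.of_continuousMulEquiv e).obLinearBound⟩
    · exact hG.exists_obLinearBound h
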